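/- Let $G=(V,E)$ be a metric graph, i.e. the complete graph on a finite nonempty set $V$ with nonnegative edge costs $c_e$ that satisfy the triangle inequality, and let $T\subseteq V$ have even cardinality. For $D\subseteq V$, a \emph{$D$-join} is a multiset $F$ of edges of $G$ such that $D$ is exactly the set of nodes of odd degree in $(V,F)$; it is \emph{connected} if the graph $(V,F)$ is connected. Let (L.P.1) be the linear program \[ \begin{array}{lll} \text{minimize} & \sum_{e\in E}c_e x_e \\ \text{subject to} & x(E(S))\le |S|-1 & \forall\, S\subsetneq V,\ |S|\ge 2,\\ & x(E(V))=|V|-1,\\ & x(\delta(S))\ge 2 & \forall\, \emptyset\ne S\subsetneq V,\ |S\cap T| \text{ even},\\ & x_e\ge 0 & \forall\, e\in E, \end{array} \] where $E(S)$ is the set of edges with both endpoints in $S$ and $\delta(S)$ is the set of edges with exactly one endpoint in $S$. The generalized Christofides algorithm takes a minimum-cost spanning tree $J$ of $G$, lets $D$ be the set of wrong-degree nodes of $J$ (the nodes of $T$ with even degree in $J$ and the nodes of $V\setminus T$ with odd degree in $J$), takes a minimum-cost $D$-join $M$, and returns the multiset union $F=J\cup M$ (an edge of $J$ is counted once more for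 each copy in $M$). Theorem. Such $J$ and $M$ exist (and $M$ can be taken to be a set of edges). For every choice of $J$ and $M$ as above, the returned multiset $F$ is a connected $T$-join. Moreover, if $x^*$ is an optimal solution of (L.P.1), with value $OPT_{LP}=\sum_{e\in E}c_e x^*_e$, then $\frac13\chi(J)+\frac13x^*$, where $\chi(J)$ is the zero-one incidence vector of $J$, is a fractional $D$-join, i.e. a vector $y\ge 0$ on $E$ with $y(\delta(U))\ge 1$ for every $U\subseteq V$ with $|U\cap D|$ odd; and the cost of $F$, counted with multiplicity, is at most $\frac53\,OPT_{LP}$. -/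

import Mathlib

namespace ConnTJoin

variable {V : Type*} [Fintype V]

/-- `G` with edge costs `c` is a metric graph: it is the complete graph on `V`, and the costs
of its edges are nonnegative and satisfy the triangle inequality. (Values of `c` at the diagonal
elements `s(v, v)`, which are not edges, are irrelevant throughout.) -/
structure IsMetricGraph (G : SimpleGraph V) (c : Sym2 V → ℝ) : Prop where
  complete : G = ⊤
  nonneg : ∀ e ∈ G.edgeSet, 0 ≤ c e
  triangle : ∀ u v w : V, u ≠ v → v ≠ w → u ≠ w → c s(u, w) ≤ c s(u, v) + c s(v, w)

open Classical in
/-- `E(S)`: the edges of `G` with both endpoints in `S`. -/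
noncomputable def edgesIn (G : SimpleGraph V) (S : Finset V) : Finset (Sym2 V) :=
  G.edgeFinset.filter (fun e => ∀ v ∈ e, v ∈ S)

open Classical in
/-- `δ(S)`: the edges of `G` with exactly one endpoint in `S`. -/
noncomputable def cut (G : SimpleGraph V) (S : Finset V) : Finset (Sym2 V) :=
  G.edgeFinset.filter (fun e => ∃ u v : V, u ∈ S ∧ v ∉ S ∧ e = s(u, v))

/-- The cost of a multiset of edges, counted with multiplicity. -/
noncomputable def cost (c : Sym2 V → ℝ) (F : Multiset (Sym2 V)) : ℝ := (F.map c).sum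

open Classical in
/-- The degree of `v` in `(V, F)`, counting parallel copies. (It is used only for multisets of
edges of simple graphs, so there are no loops.) -/
noncomputable def deg (F : Multiset (Sym2 V)) (v : V) : ℕ :=
  (F.filter (fun e => v ∈ e)).card

/-- `F` is a `T`-join of `G`: a multiset of edges of `G` such that the nodes of odd degree in
`(V, F)` are exactly those of `T`. -/
def IsJoin (G : SimpleGraph V) (T : Finset V) (F : Multiset (Sym2 V)) : Prop :=
  (∀ e ∈ F, e ∈ G.edgeSet) ∧ ∀ v : V, Odd (deg F v) ↔ v ∈ T

/-- `F` is a (spanning) connected `T`-join of `G`: a `T`-join such that the graph `(V, F)`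
is connected. -/
def IsConnectedJoin (G : SimpleGraph V) (T : Finset V) (F : Multiset (Sym2 V)) : Prop :=
  IsJoin G T F ∧ (SimpleGraph.fromEdgeSet {e | e ∈ F}).Connected

/-- `F` is a minimum-cost `T`-join of `G`. -/
def IsMinCostJoin (G : SimpleGraph V) (c : Sym2 V → ℝ) (T : Finset V)
    (F : Multiset (Sym2 V)) : Prop :=
  IsJoin G T F ∧ ∀ F' : Multiset (Sym2 V), IsJoin G T F' → cost c F ≤ cost c F'

/-- `J` is the edge set of a spanning tree of `G`. -/
def IsSpanningTree (G : SimpleGraph V) (J : Finset (Sym2 V)) : Prop :=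
  (∀ e ∈ J, e ∈ G.edgeSet) ∧ (SimpleGraph.fromEdgeSet (J : Set (Sym2 V))).IsTree

/-- `J` is the edge set of a minimum spanning tree of `G`. -/
def IsMinSpanningTree (G : SimpleGraph V) (c : Sym2 V → ℝ) (J : Finset (Sym2 V)) : Prop :=
  IsSpanningTree G J ∧
    ∀ J' : Finset (Sym2 V), IsSpanningTree G J' → cost c J.val ≤ cost c J'.val

open Classical in
/-- The wrong-degree nodes of `F` with respect to `T`: the nodes of `T` of even degree and the
nodes outside `T` of odd degree. -/
noncomputable def wrongDegree (T : Finset V) (F : Multiset (Sym2 V)) : Finset V :=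
  Finset.univ.filter (fun v => (v ∈ T ∧ Even (deg F v)) ∨ (v ∉ T ∧ Odd (deg F v)))

/-- `J` and `M` are possible choices made by the generalized Christofides algorithm on `(G, c, T)`:
`J` is a minimum spanning tree, and `M` is a minimum-cost `D`-join, where `D` is the set of
wrong-degree nodes of `J`. The algorithm then returns the multiset union `J + M`. -/
def IsChristofidesRun (G : SimpleGraph V) (c : Sym2 V → ℝ) (T : Finset V)
    (J : Finset (Sym2 V)) (M : Multiset (Sym2 V)) : Prop :=
  IsMinSpanningTree G c J ∧ IsMinCostJoin G c (wrongDegree T J.val) M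

open Classical in
/-- The feasible solutions of the linear program (L.P.1). Only the values of `x` at the edges of
`G` matter. -/
structure IsLPFeasible (G : SimpleGraph V) (T : Finset V) (x : Sym2 V → ℝ) : Prop where
  subtour : ∀ S : Finset V, S ≠ Finset.univ → 2 ≤ S.card →
    ∑ e ∈ edgesIn G S, x e ≤ (S.card : ℝ) - 1
  total : ∑ e ∈ edgesIn G Finset.univ, x e = (Fintype.card V : ℝ) - 1
  evenCut : ∀ S : Finset V, S.Nonempty → S ≠ Finset.univ →
    Even ((S ∩ T).card) → 2 ≤ ∑ e ∈ cut G S, x e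
  nonneg : ∀ e ∈ G.edgeSet, 0 ≤ x e

open Classical in
/-- The objective value `∑ e ∈ E, c e * x e`. -/
noncomputable def lpCost (G : SimpleGraph V) (c x : Sym2 V → ℝ) : ℝ :=
  ∑ e ∈ G.edgeFinset, c e * x e

/-- `x` is an optimal solution of (L.P.1), so that `lpCost G c x` is the optimal value. -/
def IsLPOptimal (G : SimpleGraph V) (c : Sym2 V → ℝ) (T : Finset V) (x : Sym2 V → ℝ) : Prop :=
  IsLPFeasible G T x ∧ ∀ x' : Sym2 V → ℝ, IsLPFeasible G T x' → lpCost G c x ≤ lpCost G c x'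

open Classical in
/-- `y` is a fractional `D`-join of `G`: a feasible solution of the linear programming
formulation of the minimum-cost `D`-join problem. -/
structure IsFractionalJoin (G : SimpleGraph V) (D : Finset V) (y : Sym2 V → ℝ) : Prop where
  oddCut : ∀ U : Finset V, Odd ((U ∩ D).card) → 1 ≤ ∑ e ∈ cut G U, y e
  nonneg : ∀ e ∈ G.edgeSet, 0 ≤ y e

open Classical in
/-- The zero-one incidence vector `χ(J)`. -/
noncomputable def incidence (J : Finset (Sym2 V)) (e : Sym2 V) : ℝ := if e ∈ J then 1 else 0

end ConnTJoin

/-! Write D for the wrong-degree nodes of J. The bound is c(F) = c(J) + c(M) with c(J) ≤ OPT and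
c(M) ≤ c(y) = (c(J) + OPT)/3 ≤ 2·OPT/3, where y = (χ(J) + x*)/3. Three facts carry it.

First, y is a fractional D-join (`IsLPFeasible.isFractionalJoin`). If |U ∩ D| is odd, then |U ∩ T|
and |J ∩ δ(U)| have different parities. When |U ∩ T| is even, x*(δ(U)) ≥ 2 and J crosses the cut at
least once. When it is odd, J crosses an even number of times, hence at least twice, and the
spanning tree constraints give x*(δ(U)) ≥ 1. Either way the two contributions add up to 3.

Second, a minimum-cost join costs no more than any fractional join (`joinDominates`,
`IsMinCostJoin.cost_le`), the Edmonds–Johnson theorem. The proof is by induction on the node set,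
and then on the support of y. A node of T with at most one support neighbor is removed. Otherwise y
is moved, without raising the cost, along a direction with zero sums at the nodes of T, until an
edge vanishes or an odd cut with at least two nodes on each side becomes tight. In the latter case
both sides are contracted and the two bounds are glued. If no direction exists, counting dimensions
and degrees makes the support a union of cycles covering T; one of them is odd, and its node set is
an odd cut of value 0, which is absurd.

Third, c(J) ≤ c(x*) (`IsMinSpanningTree.cost_le_lpCost`). Every edge of cost at most t lies inside a
component of the tree edges of cost at most t, so the subtour constraints bound the x*-weight of
these edges by their number in J. Summing over the levels t gives the claim. -/

namespace ConnTJoin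

/-! ### Two-colorings and cycles -/

section Graph

variable {W : Type*}

/-- A graph without odd cycles is 2-colorable. -/
theorem colorable_two_of_forall_cycle_even (H : SimpleGraph W)
    (h : ∀ u, ∀ p : H.Walk u u, p.IsCycle → Even p.length) : H.Colorable 2 := by
  obtain ⟨F, hFH, hF, hreach⟩ := H.exists_isAcyclic_reachable_eq_le
  obtain ⟨C⟩ := hF.colorable_two
  refine ⟨SimpleGraph.Coloring.mk C ?_⟩
  intro u v huv
  by_cases hF' : F.Adj u v
  · exact C.valid hF'
  have hr : F.Reachable v u := by rw [hreach]; exact huv.symm.reachable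
  obtain ⟨p, hp⟩ := hr.exists_isPath
  -- An edge outside the spanning forest closes a cycle with the forest path between its ends. That
  -- cycle is even, so the path is odd and its ends have different colors.
  have hcyc : ((p.mapLe hFH).cons huv).IsCycle := by
    rw [SimpleGraph.Walk.cons_isCycle_iff]
    refine ⟨hp.mapLe hFH, ?_⟩
    intro he
    have : s(u, v) ∈ p.edges := by simpa using he
    exact hF' (p.adj_of_mem_edges this)
  have heven := h u _ hcyc
  have hodd : Odd p.length := by
    simp only [SimpleGraph.Walk.length_cons, SimpleGraph.Walk.length_map] at heven
    rcases Nat.even_or_odd p.length with h' | h'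
    · exact absurd heven (Nat.not_even_iff_odd.2 h'.add_one)
    · exact h'
  intro hc
  have key : ∀ {a b : W} (q : F.Walk a b), Even q.length ↔ C a = C b := by
    intro a b q
    induction q with
    | nil => simp
    | cons hadj q ih =>
      rename_i a b d
      have := C.valid hadj
      rw [SimpleGraph.Walk.length_cons, Nat.even_add_one, ih]
      omega
  exact (Nat.not_even_iff_odd.2 hodd) ((key p).2 hc.symm)

/-- A cycle through vertices of degree two contains all neighbors of its vertices. -/
theorem mem_support_of_adj_of_degree_two [Fintype W] [DecidableEq W] (H : SimpleGraph W)
    [DecidableRel H.Adj] {u a b : W} {p : H.Walk u u} (hp : p.IsCycle) (ha : a ∈ p.support)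
    (hdeg : H.degree a = 2) (hab : H.Adj a b) : b ∈ p.support := by
  have h2 := hp.ncard_neighborSet_toSubgraph_eq_two ha
  have hsub : p.toSubgraph.neighborSet a ⊆ H.neighborSet a := fun x hx => hx.adj_sub
  have heq : p.toSubgraph.neighborSet a = H.neighborSet a := by
    apply Set.eq_of_subset_of_ncard_le hsub _ (Set.toFinite _)
    rw [h2, ← hdeg, ← SimpleGraph.card_neighborSet_eq_degree, Set.ncard_eq_toFinset_card',
      Set.toFinset_card]
  have hb : b ∈ p.toSubgraph.neighborSet a := by rw [heq]; exact hab
  have := SimpleGraph.Subgraph.Adj.snd_mem hb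
  simpa using this

theorem card_support_toFinset_of_isCycle [DecidableEq W] {H : SimpleGraph W} {u : W}
    {p : H.Walk u u} (hp : p.IsCycle) : p.support.toFinset.card = p.length := by
  have h1 : p.support.toFinset = p.support.tail.toFinset := by
    ext x
    rw [List.mem_toFinset, List.mem_toFinset, SimpleGraph.Walk.mem_support_iff]
    constructor
    · rintro (rfl | h)
      · exact SimpleGraph.Walk.end_mem_tail_support hp.not_nil
      · exact h
    · exact Or.inr
  rw [h1, List.toFinset_card_of_nodup hp.support_nodup]
  simp

end Graph

/-! ### Parities of intersections with symmetric differences -/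

section Parity

variable {W : Type*} [DecidableEq W]

theorem odd_card_inter_symmDiff (U A B : Finset W) :
    Odd (U ∩ symmDiff A B).card ↔ ¬ (Odd (U ∩ A).card ↔ Odd (U ∩ B).card) := by
  have h : (U ∩ A).card + (U ∩ B).card = (U ∩ symmDiff A B).card + 2 * (U ∩ (A ∩ B)).card := by
    have h1 : U ∩ symmDiff A B = symmDiff (U ∩ A) (U ∩ B) := by
      ext x; simp only [Finset.mem_inter, Finset.mem_symmDiff]; tauto
    have h2 : U ∩ (A ∩ B) = (U ∩ A) ∩ (U ∩ B) := by
      ext x; simp only [Finset.mem_inter]; tauto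
    rw [h1, h2]
    generalize U ∩ A = X
    generalize U ∩ B = Y
    have h3 : (symmDiff X Y).card = (X \ Y).card + (Y \ X).card := by
      rw [symmDiff_def, Finset.sup_eq_union, Finset.card_union_of_disjoint]
      exact disjoint_sdiff_sdiff
    have h4 := Finset.card_sdiff_add_card_inter X Y
    have h5 := Finset.card_sdiff_add_card_inter Y X
    rw [Finset.inter_comm] at h5
    omega
  simp only [Nat.odd_iff]
  omega

theorem odd_card_inter_pair (U : Finset W) {u v : W} (huv : u ≠ v) :
    Odd (U ∩ {u, v}).card ↔ ¬ (u ∈ U ↔ v ∈ U) := by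
  by_cases hu : u ∈ U <;> by_cases hv : v ∈ U <;>
    simp [hu, hv, Finset.inter_insert_of_mem, Finset.inter_insert_of_notMem, huv,
      Finset.inter_singleton_of_mem, Finset.inter_singleton_of_notMem]

theorem odd_card_inter_symmDiff_pair (U A : Finset W) {u v : W} (huv : u ≠ v) :
    Odd (U ∩ symmDiff A {u, v}).card ↔ (Odd (U ∩ A).card ↔ (u ∈ U ↔ v ∈ U)) := by
  rw [odd_card_inter_symmDiff, odd_card_inter_pair U huv]; tauto

theorem even_card_symmDiff_pair {A : Finset W} (hA : Even A.card) {u v : W} (huv : u ≠ v) :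
    Even (symmDiff A {u, v}).card := by
  have h := odd_card_inter_symmDiff_pair (A ∪ {u, v}) A huv
  have h1 : (A ∪ {u, v}) ∩ symmDiff A {u, v} = symmDiff A {u, v} := by
    ext x; simp only [Finset.mem_inter, Finset.mem_union, Finset.mem_symmDiff]; tauto
  have h2 : (A ∪ {u, v}) ∩ A = A := by ext x; simp; tauto
  rw [h1, h2] at h
  rw [← Nat.not_odd_iff_even] at hA ⊢
  simp [h, hA]

theorem even_card_symmDiff_singleton {A : Finset W} (hA : Odd A.card) (u : W) :
    Even (symmDiff A {u}).card := by
  have h := odd_card_inter_symmDiff (A ∪ {u}) A {u}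
  have h1 : (A ∪ {u}) ∩ symmDiff A {u} = symmDiff A {u} := by
    ext x; simp only [Finset.mem_inter, Finset.mem_union, Finset.mem_symmDiff]; tauto
  have h2 : (A ∪ {u}) ∩ A = A := by ext x; simp; tauto
  have h3 : (A ∪ {u}) ∩ {u} = {u} := by ext x; simp
  rw [h1, h2, h3] at h
  rw [← Nat.not_odd_iff_even]
  simp [h, hA]

end Parity

/-! ### Joins built edge by edge -/

section Joins

variable {W : Type*} [DecidableEq W]

/-- `JoinCost S c T r`: there is a `T`-join of cost `r` using edges inside `S`. -/
inductive JoinCost (S : Finset W) (c : W → W → ℝ) : Finset W → ℝ → Prop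
  | nil : JoinCost S c ∅ 0
  | cons {T : Finset W} {r : ℝ} {u v : W} : u ∈ S → v ∈ S → u ≠ v → JoinCost S c T r →
      JoinCost S c (symmDiff T {u, v}) (r + c u v)

theorem JoinCost.mono {S S' : Finset W} (h : S ⊆ S') {c : W → W → ℝ} {T : Finset W} {r : ℝ}
    (hj : JoinCost S c T r) : JoinCost S' c T r := by
  induction hj with
  | nil => exact .nil
  | cons hu hv huv _ ih => exact .cons (h hu) (h hv) huv ih

theorem JoinCost.add {S : Finset W} {c : W → W → ℝ} {T T' : Finset W} {r r' : ℝ}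
    (hj : JoinCost S c T r) (hj' : JoinCost S c T' r') :
    JoinCost S c (symmDiff T T') (r + r') := by
  induction hj' with
  | nil => rwa [add_zero, ← Finset.bot_eq_empty, symmDiff_bot]
  | cons hu hv huv _ ih =>
    rw [← symmDiff_assoc, ← add_assoc]
    exact .cons hu hv huv ih

theorem JoinCost.nonneg {S : Finset W} {c : W → W → ℝ} (hc : ∀ u v, 0 ≤ c u v) {T : Finset W}
    {r : ℝ} (hj : JoinCost S c T r) : 0 ≤ r := by
  induction hj with
  | nil => exact le_rfl
  | cons hu hv huv _ ih => exact add_nonneg ih (hc _ _)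

/-- Pair up the nodes of `T` and join each pair by its edge. -/
theorem JoinCost.exists_of_even {S : Finset W} (c : W → W → ℝ) :
    ∀ (n : ℕ) (T : Finset W), T.card = n → T ⊆ S → Even T.card → ∃ r, JoinCost S c T r := by
  intro n
  induction n using Nat.strong_induction_on with
  | _ n ih =>
    intro T hn hTS hT
    rcases T.eq_empty_or_nonempty with rfl | ⟨u, hu⟩
    · exact ⟨0, .nil⟩
    have h1 : 1 < T.card := by
      have := Finset.card_pos.2 ⟨u, hu⟩
      rcases hT with ⟨k, hk⟩; omega
    obtain ⟨v, hv, hvu⟩ := Finset.exists_mem_ne h1 u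
    have hT' : symmDiff T {u, v} ⊆ T := by
      intro x; simp only [Finset.mem_symmDiff, Finset.mem_insert, Finset.mem_singleton]
      rintro (h | ⟨rfl | rfl, h⟩)
      · exact h.1
      · exact hu
      · exact hv
    have hlt : (symmDiff T {u, v}).card < T.card := by
      apply Finset.card_lt_card
      refine ⟨hT', fun h => ?_⟩
      have := h hu
      simp [Finset.mem_symmDiff, hu] at this
    obtain ⟨r, hr⟩ := ih _ (hn ▸ hlt) _ rfl (hT'.trans hTS) (even_card_symmDiff_pair hT hvu.symm)
    have := JoinCost.cons (hTS hu) (hTS hv) hvu.symm hr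
    rw [symmDiff_symmDiff_cancel_right] at this
    exact ⟨_, this⟩

end Joins

/-! ### Fractional joins dominate joins (Edmonds–Johnson) -/

section Dominance

variable {W : Type*} [DecidableEq W]

/-- `y` is a fractional `T`-join on the complete graph with node set `S`. -/
structure FracJoin (S T : Finset W) (y : W → W → ℝ) : Prop where
  symm : ∀ u v, y u v = y v u
  diag : ∀ u, y u u = 0
  nonneg : ∀ u v, 0 ≤ y u v
  oddCut : ∀ U ⊆ S, Odd (U ∩ T).card → 1 ≤ ∑ u ∈ U, ∑ w ∈ S \ U, y u w

/-- Every fractional `T`-join on `S` costs at least as much as some `T`-join, for all `T`.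
(The double sum counts every edge twice.) -/
def JoinDominates (S : Finset W) : Prop :=
  ∀ T ⊆ S, Even T.card → ∀ c : W → W → ℝ, (∀ u v, c u v = c v u) → (∀ u v, 0 ≤ c u v) →
    ∀ y, FracJoin S T y → ∀ B, (∀ r, JoinCost S c T r → B ≤ r) →
      2 * B ≤ ∑ u ∈ S, ∑ w ∈ S, c u w * y u w

theorem cutSum_compl {S U : Finset W} (hU : U ⊆ S) {y : W → W → ℝ} (hy : ∀ u v, y u v = y v u) :
    ∑ u ∈ S \ U, ∑ w ∈ S \ (S \ U), y u w = ∑ u ∈ U, ∑ w ∈ S \ U, y u w := by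
  rw [Finset.sdiff_sdiff_eq_self hU, Finset.sum_comm]
  exact Finset.sum_congr rfl fun u _ => Finset.sum_congr rfl fun w _ => hy _ _

theorem odd_sdiff_inter {S T U : Finset W} (hT : T ⊆ S) (hTe : Even T.card)
    (h : Odd (U ∩ T).card) : Odd ((S \ U) ∩ T).card := by
  have h1 : (S \ U) ∩ T = T \ (U ∩ T) := by
    ext x; simp only [Finset.mem_inter, Finset.mem_sdiff]
    constructor
    · tauto
    · rintro ⟨a, b⟩; exact ⟨⟨hT a, fun h => b ⟨h, a⟩⟩, a⟩
  rw [h1]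
  have := Finset.card_sdiff_add_card_eq_card (Finset.inter_subset_right : U ∩ T ⊆ T)
  rw [Nat.even_iff] at hTe
  rw [Nat.odd_iff] at h ⊢
  omega

/-- It suffices to check the odd cuts avoiding a fixed node. -/
theorem FracJoin.mk_of_notMem {S T : Finset W} (hT : T ⊆ S) (hTe : Even T.card) {y : W → W → ℝ}
    (r : W) (symm : ∀ u v, y u v = y v u) (diag : ∀ u, y u u = 0) (nonneg : ∀ u v, 0 ≤ y u v)
    (h : ∀ U ⊆ S, r ∉ U → Odd (U ∩ T).card → 1 ≤ ∑ u ∈ U, ∑ w ∈ S \ U, y u w) :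
    FracJoin S T y := by
  refine ⟨symm, diag, nonneg, fun U hU hodd => ?_⟩
  by_cases hr : r ∈ U
  · rw [← cutSum_compl hU symm]
    exact h _ Finset.sdiff_subset (by simp [hr]) (odd_sdiff_inter hT hTe hodd)
  · exact h U hU hr hodd

/-- The infimal cost of a `T`-join inside `S`. -/
noncomputable def joinInf (S : Finset W) (c : W → W → ℝ) (T : Finset W) : ℝ :=
  sInf {r | JoinCost S c T r}

theorem joinInf_le {S : Finset W} {c : W → W → ℝ} (hc : ∀ u v, 0 ≤ c u v) {T : Finset W} {r : ℝ}
    (h : JoinCost S c T r) : joinInf S c T ≤ r :=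
  csInf_le ⟨0, fun _ hr => JoinCost.nonneg hc hr⟩ h

/-- Evenness makes the set of join costs nonempty, so the real `sInf` is a genuine infimum and not
the default value 0. -/
theorem le_joinInf {S : Finset W} (c : W → W → ℝ) {T : Finset W} (hTS : T ⊆ S)
    (hT : Even T.card) {b : ℝ} (h : ∀ r, JoinCost S c T r → b ≤ r) : b ≤ joinInf S c T :=
  le_csInf (JoinCost.exists_of_even c _ T rfl hTS hT) h

/-- The costs after contracting everything outside `U` to the node `r`, where the edge from `u`
to `r` gets cost `p u`. -/
def contractCost (r : W) (c : W → W → ℝ) (p : W → ℝ) (u w : W) : ℝ :=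
  if u = r then p w else if w = r then p u else c u w

/-- The vector `y` after contracting everything outside `U` to the node `r`, where the edge
from `u` to `r` gets value `Y u`. -/
def contractVec (r : W) (y : W → W → ℝ) (Y : W → ℝ) (u w : W) : ℝ :=
  if u = r then (if w = r then 0 else Y w) else if w = r then Y u else y u w

/-- The three outcomes correspond to a join using no edge at `r`, exactly one, or at least two; in
the last case these edges alone cost `2 * b`. `aux` handles the addition of one more edge at `r`. -/
theorem JoinCost.of_contract {U : Finset W} {r : W} (hr : r ∉ U) {c : W → W → ℝ}
    (hc : ∀ u v, 0 ≤ c u v) {p : W → ℝ} {b : ℝ} (hb : 0 ≤ b) (hp : ∀ u ∈ U, b ≤ p u)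
    {X : Finset W} {ρ : ℝ} (h : JoinCost (insert r U) (contractCost r c p) X ρ) :
    (r ∉ X ∧ JoinCost U c X ρ) ∨
    (r ∈ X ∧ ∃ u ∈ U, ∃ ρ', JoinCost U c (symmDiff (X.erase r) {u}) ρ' ∧ ρ = ρ' + p u) ∨
    2 * b ≤ ρ := by
  have aux : ∀ {X : Finset W} {ρ : ℝ} {a : W}, a ∈ U →
      ((r ∉ X ∧ JoinCost U c X ρ) ∨
        (r ∈ X ∧ ∃ u ∈ U, ∃ ρ', JoinCost U c (symmDiff (X.erase r) {u}) ρ' ∧ ρ = ρ' + p u) ∨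
        2 * b ≤ ρ) →
      ((r ∉ symmDiff X {a, r} ∧ JoinCost U c (symmDiff X {a, r}) (ρ + p a)) ∨
        (r ∈ symmDiff X {a, r} ∧ ∃ u ∈ U, ∃ ρ', JoinCost U c
          (symmDiff ((symmDiff X {a, r}).erase r) {u}) ρ' ∧ ρ + p a = ρ' + p u) ∨
        2 * b ≤ ρ + p a) := by
    intro X ρ a ha h
    have har : a ≠ r := fun h => hr (h ▸ ha)
    rcases h with ⟨h1, h2⟩ | ⟨h1, u, hu, ρ', h2, h3⟩ | h
    · refine Or.inr (Or.inl ⟨by simp [Finset.mem_symmDiff, h1], a, ha, ρ, ?_, rfl⟩)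
      have : symmDiff ((symmDiff X {a, r}).erase r) {a} = X := by
        ext x
        simp only [Finset.mem_symmDiff, Finset.mem_erase, Finset.mem_insert, Finset.mem_singleton]
        by_cases hx : x = r
        · subst hx; simp [h1, har.symm]
        · by_cases hxa : x = a
          · subst hxa; simp [hx]
          · simp [hx, hxa]
      rwa [this]
    · refine Or.inr (Or.inr ?_)
      have := JoinCost.nonneg hc h2
      have := hp u hu
      have := hp a ha
      linarith
    · refine Or.inr (Or.inr ?_)
      have := hp a ha
      linarith
  have hne : ∀ {u}, u ∈ U → u ≠ r := fun hu h => hr (h ▸ hu)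
  induction h with
  | nil => exact Or.inl ⟨by simp, .nil⟩
  | @cons X ρ u v hu hv huv _ ih =>
    rcases Finset.mem_insert.1 hu with rfl | hu'
    · have hv' : v ∈ U := (Finset.mem_insert.1 hv).resolve_left huv.symm
      have := aux hv' ih
      rw [Finset.pair_comm] at this
      simpa only [contractCost, if_true] using this
    rcases Finset.mem_insert.1 hv with rfl | hv'
    · have := aux hu' ih
      simpa only [contractCost, if_true, if_neg huv] using this
    have hcc : contractCost r c p u v = c u v := by
      simp [contractCost, hne hu', hne hv']
    rw [hcc]
    have hmem : r ∈ symmDiff X {u, v} ↔ r ∈ X := by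
      simp [Finset.mem_symmDiff, (hne hu').symm, (hne hv').symm]
    rw [hmem]
    rcases ih with ⟨h1, h2⟩ | ⟨h1, a, ha, ρ', h2, h3⟩ | h
    · exact Or.inl ⟨h1, .cons hu' hv' huv h2⟩
    · refine Or.inr (Or.inl ⟨h1, a, ha, ρ' + c u v, ?_, by rw [h3]; ring⟩)
      have h4 := JoinCost.cons hu' hv' huv h2
      have : symmDiff ((symmDiff X {u, v}).erase r) {a}
          = symmDiff (symmDiff (X.erase r) {a}) {u, v} := by
        have h5 : (symmDiff X {u, v}).erase r = symmDiff (X.erase r) {u, v} := by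
          ext x
          by_cases hx : x = r
          · subst hx; simp [Finset.mem_symmDiff, (hne hu').symm, (hne hv').symm]
          · simp [Finset.mem_symmDiff, hx]
        rw [h5, symmDiff_right_comm]
      rwa [this]
    · have := hc u v
      exact Or.inr (Or.inr (by linarith))

/-- One side of the gluing argument along a tight odd cut. -/
theorem sum_joinInf_mul_le {S T U : Finset W} (hUS : U ⊆ S) {r : W} (hr : r ∉ U)
    (hdom : JoinDominates (insert r U)) {c y : W → W → ℝ} (hcs : ∀ u v, c u v = c v u)
    (hc : ∀ u v, 0 ≤ c u v) (hy : FracJoin S T y) (hodd : Odd (U ∩ T).card)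
    (htight : ∑ u ∈ U, ∑ w ∈ S \ U, y u w = 1) :
    2 * ∑ u ∈ U, joinInf U c (symmDiff (U ∩ T) {u}) * ∑ w ∈ S \ U, y u w
      ≤ ∑ u ∈ U, ∑ w ∈ U, c u w * y u w := by
  set α : W → ℝ := fun u => joinInf U c (symmDiff (U ∩ T) {u}) with hα
  set Y : W → ℝ := fun u => ∑ w ∈ S \ U, y u w with hY
  have hne : ∀ {u}, u ∈ U → u ≠ r := fun hu h => hr (h ▸ hu)
  -- The edge from `u` to the contracted node will cost `2 * A - α u`, which is at least `A`. A join
  -- using one such edge then costs at least `α u + (2 * A - α u)`, and one using more costs at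
  -- least `A + A`.
  obtain ⟨A, hA0, hA⟩ : ∃ A : ℝ, 0 ≤ A ∧ ∀ u ∈ U, α u ≤ A := by
    refine ⟨∑ u ∈ U, |α u|, Finset.sum_nonneg fun _ _ => abs_nonneg _, fun u hu => ?_⟩
    exact (le_abs_self _).trans
      (Finset.single_le_sum (f := fun u => |α u|) (fun _ _ => abs_nonneg _) hu)
  -- The truncation only serves the nodes outside `U`, where `α` is not bounded by `A` but costs
  -- must still be nonnegative.
  have hp0 : ∀ u, 0 ≤ max (2 * A - α u) 0 := fun u => le_max_right _ _
  have hpU : ∀ u ∈ U, max (2 * A - α u) 0 = 2 * A - α u := fun u hu =>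
    max_eq_left (by have := hA u hu; linarith)
  have hY0 : ∀ u, 0 ≤ Y u := fun u => Finset.sum_nonneg fun w _ => hy.nonneg u w
  set p : W → ℝ := fun u => max (2 * A - α u) 0 with hp
  have hrT : r ∉ U ∩ T := fun h => hr (Finset.mem_inter.1 h).1
  have hT'e : Even (insert r (U ∩ T)).card := by
    rw [Finset.card_insert_of_notMem hrT]; exact hodd.add_one
  have hT'S : insert r (U ∩ T) ⊆ insert r U := Finset.insert_subset_insert _ Finset.inter_subset_left
  have key := hdom (insert r (U ∩ T)) hT'S hT'e (contractCost r c p)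
    (by
      intro u v
      by_cases hu : u = r <;> by_cases hv : v = r <;> simp [contractCost, hu, hv, hcs u v])
    (by
      intro u v
      by_cases hu : u = r <;> by_cases hv : v = r <;> simp [contractCost, hu, hv, hc u v, hp])
    (contractVec r y Y)
    (by
      refine FracJoin.mk_of_notMem hT'S hT'e r ?_ ?_ ?_ ?_
      · intro u v
        by_cases hu : u = r <;> by_cases hv : v = r <;> simp [contractVec, hu, hv, hy.symm u v]
      · intro u
        by_cases hu : u = r <;> simp [contractVec, hu, hy.diag]
      · intro u v
        by_cases hu : u = r <;> by_cases hv : v = r <;>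
          simp [contractVec, hu, hv, hy.nonneg u v, hY0]
      -- A cut avoiding the contracted node has the same value before and after contraction.
      · intro U' hU' hrU' hodd'
        have hU'U : U' ⊆ U := fun x hx =>
          (Finset.mem_insert.1 (hU' hx)).resolve_left (fun h => hrU' (h ▸ hx))
        have h1 : U' ∩ insert r (U ∩ T) = U' ∩ T := by
          rw [Finset.inter_insert_of_notMem hrU', ← Finset.inter_assoc,
            Finset.inter_eq_left.2 hU'U]
        rw [h1] at hodd'
        refine (hy.oddCut U' (hU'U.trans hUS) hodd').trans (le_of_eq ?_)
        refine Finset.sum_congr rfl fun u hu => ?_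
        have hur := hne (hU'U hu)
        have h2 : insert r U \ U' = insert r (U \ U') := Finset.insert_sdiff_of_notMem _ hrU'
        have h3 : S \ U' = (S \ U) ∪ (U \ U') := by
          ext x; simp only [Finset.mem_sdiff, Finset.mem_union]
          constructor
          · intro h; by_cases hx : x ∈ U <;> tauto
          · rintro (h | h)
            · exact ⟨h.1, fun h' => h.2 (hU'U h')⟩
            · exact ⟨hUS h.1, h.2⟩
        rw [h2, Finset.sum_insert (by simp [hr]), h3, Finset.sum_union]
        · congr 1
          · simp [contractVec, hur, hY]
          · refine Finset.sum_congr rfl fun w hw => ?_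
            simp [contractVec, hur, hne (Finset.mem_sdiff.1 hw).1]
        · exact Finset.disjoint_left.2 fun x hx hx' =>
            (Finset.mem_sdiff.1 hx).2 (Finset.mem_sdiff.1 hx').1)
    (2 * A)
    (by
      intro ρ hρ
      rcases hρ.of_contract hr hc hA0 (fun u hu => by rw [hp]; simp only; rw [hpU u hu]; linarith [hA u hu])
        with ⟨h, _⟩ | ⟨_, u, hu, ρ', h2, h3⟩ | h
      · exact absurd (Finset.mem_insert_self _ _) h
      · rw [Finset.erase_insert hrT] at h2
        have := joinInf_le hc h2
        have h4 : p u = 2 * A - α u := hpU u hu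
        rw [h3, h4]
        have h5 : α u ≤ ρ' := this
        linarith
      · exact h)
  have hsum : ∑ u ∈ insert r U, ∑ w ∈ insert r U, contractCost r c p u w * contractVec r y Y u w
      = ∑ u ∈ U, ∑ w ∈ U, c u w * y u w + 2 * ∑ u ∈ U, (2 * A - α u) * Y u := by
    rw [Finset.sum_insert hr, Finset.sum_insert hr]
    have e1 : ∑ w ∈ U, contractCost r c p r w * contractVec r y Y r w
        = ∑ u ∈ U, (2 * A - α u) * Y u :=
      Finset.sum_congr rfl fun w hw => by
        simp only [contractCost, contractVec, if_true, if_neg (hne hw)]; rw [← hpU w hw]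
    have e2 : ∑ u ∈ U, ∑ w ∈ insert r U, contractCost r c p u w * contractVec r y Y u w
        = ∑ u ∈ U, (2 * A - α u) * Y u + ∑ u ∈ U, ∑ w ∈ U, c u w * y u w := by
      rw [← Finset.sum_add_distrib]
      refine Finset.sum_congr rfl fun u hu => ?_
      rw [Finset.sum_insert hr]
      congr 1
      · simp only [contractCost, contractVec, if_true, if_neg (hne hu)]; rw [← hpU u hu]
      · refine Finset.sum_congr rfl fun w hw => ?_
        simp only [contractCost, contractVec, if_neg (hne hu), if_neg (hne hw)]
    rw [e1, e2]
    simp only [contractVec, if_true, mul_zero, zero_add]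
    ring
  -- Tightness enters here: the values `Y u` sum to 1, so `A` will cancel from `key`.
  have hsum2 : ∑ u ∈ U, (2 * A - α u) * Y u = 2 * A - ∑ u ∈ U, α u * Y u := by
    simp only [sub_mul, Finset.sum_sub_distrib, ← Finset.mul_sum]
    rw [htight, mul_one]
  rw [hsum, hsum2] at key
  linarith

/-- For a cut edge `uw`, a join on each side with the parity corrected at `u` and at `w`, together
with `uw`, is a `T`-join. Averaging the resulting bound on `B` with the weights `y u w`, which sum
to 1 on the tight cut, reduces the claim to `sum_joinInf_mul_le` on the two sides. Both contracted
node sets are smaller than `S` because each side has at least two nodes. -/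
theorem le_of_tight_oddCut {S T U : Finset W}
    (ih : ∀ S' : Finset W, S'.card < S.card → JoinDominates S') (hT : T ⊆ S) (hTe : Even T.card)
    {c y : W → W → ℝ} (hcs : ∀ u v, c u v = c v u) (hc : ∀ u v, 0 ≤ c u v) (hy : FracJoin S T y)
    (hUS : U ⊆ S) (hodd : Odd (U ∩ T).card) (hU : 2 ≤ U.card) (hU' : 2 ≤ (S \ U).card)
    (htight : ∑ u ∈ U, ∑ w ∈ S \ U, y u w = 1) {B : ℝ} (hB : ∀ r, JoinCost S c T r → B ≤ r) :
    2 * B ≤ ∑ u ∈ S, ∑ w ∈ S, c u w * y u w := by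
  obtain ⟨r, hr⟩ : (S \ U).Nonempty := Finset.card_pos.1 (by omega)
  obtain ⟨r', hr'⟩ : U.Nonempty := Finset.card_pos.1 (by omega)
  have hcard := Finset.card_sdiff_add_card_eq_card hUS
  have hrU : r ∉ U := (Finset.mem_sdiff.1 hr).2
  have hr'U : r' ∉ S \ U := fun h => (Finset.mem_sdiff.1 h).2 hr'
  have hodd' := odd_sdiff_inter (U := U) hT hTe hodd
  have k1 := sum_joinInf_mul_le hUS hrU
    (ih _ (by rw [Finset.card_insert_of_notMem hrU]; omega)) hcs hc hy hodd htight
  have k2 := sum_joinInf_mul_le (U := S \ U) Finset.sdiff_subset hr'U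
    (ih _ (by rw [Finset.card_insert_of_notMem hr'U]; omega)) hcs hc hy hodd'
    (by rw [cutSum_compl hUS hy.symm]; exact htight)
  rw [Finset.sdiff_sdiff_eq_self hUS] at k2
  set X := S \ U with hX
  have hsplit : ∀ f : W → ℝ, ∑ u ∈ S, f u = ∑ u ∈ U, f u + ∑ u ∈ X, f u := fun f => by
    rw [hX, add_comm, Finset.sum_sdiff hUS]
  have hpt : ∀ u ∈ U, ∀ w ∈ X, B ≤ joinInf U c (symmDiff (U ∩ T) {u}) +
      joinInf X c (symmDiff (X ∩ T) {w}) + c u w := by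
    intro u hu w hw
    have huw : u ≠ w := fun h => (Finset.mem_sdiff.1 hw).2 (h ▸ hu)
    have h1 : B - c u w - joinInf X c (symmDiff (X ∩ T) {w})
        ≤ joinInf U c (symmDiff (U ∩ T) {u}) := by
      refine le_joinInf c ?_ (even_card_symmDiff_singleton hodd u) fun r1 hr1 => ?_
      · intro x; simp only [Finset.mem_symmDiff, Finset.mem_inter, Finset.mem_singleton]
        rintro (h | h)
        · exact h.1.1
        · exact h.1 ▸ hu
      have h2 : B - c u w - r1 ≤ joinInf X c (symmDiff (X ∩ T) {w}) := by
        refine le_joinInf c ?_ (even_card_symmDiff_singleton hodd' w) fun r2 hr2 => ?_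
        · intro x; simp only [Finset.mem_symmDiff, Finset.mem_inter, Finset.mem_singleton]
          rintro (h | h)
          · exact h.1.1
          · exact h.1 ▸ hw
        have h3 := JoinCost.cons (hUS hu) (Finset.sdiff_subset hw) huw
          ((hr1.mono hUS).add (hr2.mono Finset.sdiff_subset))
        have h4 : symmDiff (symmDiff (symmDiff (U ∩ T) {u}) (symmDiff (X ∩ T) {w})) {u, w}
            = T := by
          have h5 : symmDiff (U ∩ T) (X ∩ T) = T := by
            ext x
            have hxX : x ∈ X ↔ x ∈ S ∧ x ∉ U := by rw [hX, Finset.mem_sdiff]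
            by_cases hxT : x ∈ T
            · by_cases hxU : x ∈ U <;> simp [Finset.mem_symmDiff, hxX, hxU, hxT, hT hxT]
            · simp [Finset.mem_symmDiff, hxT]
          have h6 : symmDiff {u} {w} = ({u, w} : Finset W) := by
            ext x
            by_cases h1 : x = u
            · subst h1; simp [Finset.mem_symmDiff, huw]
            · simp [Finset.mem_symmDiff, h1]
          rw [symmDiff_symmDiff_symmDiff_comm, h5, h6, symmDiff_symmDiff_cancel_right]
        rw [h4] at h3
        have := hB _ h3
        linarith
      linarith
    linarith
  have hB1 : B ≤ ∑ u ∈ U, ∑ w ∈ X, (joinInf U c (symmDiff (U ∩ T) {u}) +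
      joinInf X c (symmDiff (X ∩ T) {w}) + c u w) * y u w := by
    calc B = B * ∑ u ∈ U, ∑ w ∈ X, y u w := by rw [htight, mul_one]
      _ = ∑ u ∈ U, ∑ w ∈ X, B * y u w := by simp only [Finset.mul_sum]
      _ ≤ _ := Finset.sum_le_sum fun u hu => Finset.sum_le_sum fun w hw =>
          mul_le_mul_of_nonneg_right (hpt u hu w hw) (hy.nonneg u w)
  have hB2 : ∑ u ∈ U, ∑ w ∈ X, (joinInf U c (symmDiff (U ∩ T) {u}) +
      joinInf X c (symmDiff (X ∩ T) {w}) + c u w) * y u w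
      = ∑ u ∈ U, joinInf U c (symmDiff (U ∩ T) {u}) * ∑ w ∈ X, y u w
        + ∑ w ∈ X, joinInf X c (symmDiff (X ∩ T) {w}) * ∑ u ∈ U, y w u
        + ∑ u ∈ U, ∑ w ∈ X, c u w * y u w := by
    simp only [add_mul, Finset.sum_add_distrib, Finset.mul_sum]
    congr 2
    rw [Finset.sum_comm]
    exact Finset.sum_congr rfl fun w _ => Finset.sum_congr rfl fun u _ => by rw [hy.symm]
  have hB3 : ∑ u ∈ X, ∑ w ∈ U, c u w * y u w = ∑ u ∈ U, ∑ w ∈ X, c u w * y u w := by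
    rw [Finset.sum_comm]
    exact Finset.sum_congr rfl fun w _ => Finset.sum_congr rfl fun u _ => by rw [hy.symm, hcs]
  have hS : ∑ u ∈ S, ∑ w ∈ S, c u w * y u w = ∑ u ∈ U, ∑ w ∈ U, c u w * y u w
      + ∑ u ∈ X, ∑ w ∈ X, c u w * y u w + 2 * ∑ u ∈ U, ∑ w ∈ X, c u w * y u w := by
    simp only [hsplit, Finset.sum_add_distrib]
    rw [hB3]; ring
  rw [hS]
  linarith

/-- The odd cut `{v}` forces `y v u ≥ 1`, so `y` pays for the edge `vu`. After deleting `v` and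
toggling `u`, the rest of `y` is still a fractional join, and adding `vu` to a join there gives a
`T`-join. -/
theorem le_of_leaf {S T : Finset W} {v u : W} (hdom : JoinDominates (S.erase v)) (hT : T ⊆ S)
    (hTe : Even T.card) {c y : W → W → ℝ} (hcs : ∀ u v, c u v = c v u) (hc : ∀ u v, 0 ≤ c u v)
    (hy : FracJoin S T y) (hv : v ∈ T) (hu : u ∈ S) (huv : v ≠ u)
    (hleaf : ∀ w ∈ S, w ≠ u → y v w = 0) {B : ℝ} (hB : ∀ r, JoinCost S c T r → B ≤ r) :
    2 * B ≤ ∑ u ∈ S, ∑ w ∈ S, c u w * y u w := by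
  have hvS := hT hv
  have huS : u ∈ S.erase v := Finset.mem_erase.2 ⟨huv.symm, hu⟩
  have hsum : ∀ f : W → ℝ, ∑ w ∈ S, f w = f v + ∑ w ∈ S.erase v, f w := fun f =>
    (Finset.add_sum_erase S f hvS).symm
  have hyvu : 1 ≤ y v u := by
    have h := hy.oddCut {v} (by simpa using hvS) (by
      rw [Finset.inter_comm, Finset.inter_singleton_of_mem hv]; simp)
    rw [Finset.sum_singleton, Finset.sdiff_singleton_eq_erase, Finset.sum_eq_single_of_mem u huS
      (fun w hw hwu => hleaf w (Finset.mem_of_mem_erase hw) hwu)] at h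
    exact h
  have hT' : symmDiff T {v, u} ⊆ S.erase v := by
    intro x
    simp only [Finset.mem_symmDiff, Finset.mem_insert, Finset.mem_singleton, Finset.mem_erase]
    rintro (⟨h1, h2⟩ | ⟨rfl | rfl, h2⟩)
    · exact ⟨fun h => h2 (Or.inl h), hT h1⟩
    · exact absurd hv h2
    · exact ⟨huv.symm, hu⟩
  have hyF : FracJoin (S.erase v) (symmDiff T {v, u}) y := by
    refine ⟨hy.symm, hy.diag, hy.nonneg, fun U hU hodd => ?_⟩
    have hUS : U ⊆ S := hU.trans (Finset.erase_subset _ _)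
    have hvU : v ∉ U := fun h => by simpa using hU h
    rw [odd_card_inter_symmDiff_pair U T huv] at hodd
    -- If `u ∈ U`, adding `v` gives a `T`-odd set, and `v` sends nothing out of it. If `u ∉ U`, then
    -- `U` is itself `T`-odd and receives nothing from `v`.
    by_cases huU : u ∈ U
    · have h1 : Odd ((insert v U) ∩ T).card := by
        rw [Finset.insert_inter_of_mem hv, Finset.card_insert_of_notMem (by simp [hvU])]
        simp only [hvU, huU, iff_true, iff_false] at hodd
        exact (Nat.not_odd_iff_even.1 hodd).add_one
      have h2 := hy.oddCut _ (Finset.insert_subset hvS hUS) h1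
      have h3 : S \ insert v U = S.erase v \ U := by
        ext x; simp only [Finset.mem_sdiff, Finset.mem_insert, Finset.mem_erase]; tauto
      rw [Finset.sum_insert hvU, h3] at h2
      have h4 : ∑ w ∈ S.erase v \ U, y v w = 0 := Finset.sum_eq_zero fun w hw => by
        rw [Finset.mem_sdiff, Finset.mem_erase] at hw
        exact hleaf w hw.1.2 fun h => hw.2 (h ▸ huU)
      linarith
    · have h1 : Odd (U ∩ T).card := by simpa [hvU, huU] using hodd
      have h2 := hy.oddCut _ hUS h1
      refine h2.trans (le_of_eq (Finset.sum_congr rfl fun x hx => ?_))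
      have h3 : S \ U = insert v (S.erase v \ U) := by
        ext x; simp only [Finset.mem_sdiff, Finset.mem_insert, Finset.mem_erase]
        by_cases hxv : x = v
        · subst hxv; simp [hvS, hvU]
        · simp [hxv]
      rw [h3, Finset.sum_insert (by simp), hy.symm x v, hleaf x (hUS hx) (fun h => huU (h ▸ hx)),
        zero_add]
  have key := hdom _ hT' (even_card_symmDiff_pair hTe huv) c hcs hc y hyF (B - c v u) (by
    intro r hr
    have h := JoinCost.cons hvS hu huv (hr.mono (Finset.erase_subset v S))
    rw [symmDiff_symmDiff_cancel_right] at h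
    linarith [hB _ h])
  have e1 : ∑ w ∈ S.erase v, c v w * y v w = c v u * y v u :=
    Finset.sum_eq_single_of_mem u huS fun w hw hwu => by
      rw [hleaf w (Finset.mem_of_mem_erase hw) hwu, mul_zero]
  have e2 : ∑ w ∈ S.erase v, c w v * y w v = c v u * y v u := by
    rw [← e1]; exact Finset.sum_congr rfl fun w _ => by rw [hcs, hy.symm]
  have e3 : ∑ a ∈ S, ∑ w ∈ S, c a w * y a w
      = 2 * (c v u * y v u) + ∑ a ∈ S.erase v, ∑ w ∈ S.erase v, c a w * y a w := by
    rw [hsum, hsum (fun w => c v w * y v w), e1, hy.diag]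
    simp only [fun a => hsum (fun w => c a w * y a w), Finset.sum_add_distrib]
    rw [e2]; ring
  have := mul_le_mul_of_nonneg_left hyvu (hc v u)
  rw [e3]; linarith

/-- The ratio test of the simplex method: the step length is the least `a i / -b i` over the
decreasing coordinates. -/
theorem exists_max_step {ι : Type*} (I : Finset ι) (a b : ι → ℝ) (ha : ∀ i ∈ I, 0 ≤ a i)
    (hb : ∃ i ∈ I, b i < 0) :
    ∃ ε : ℝ, 0 ≤ ε ∧ (∀ i ∈ I, 0 ≤ a i + ε * b i) ∧ ∃ i ∈ I, b i < 0 ∧ a i + ε * b i = 0 := by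
  obtain ⟨i₀, hi₀, hbi₀⟩ := hb
  have hne : (I.filter (fun i => b i < 0)).Nonempty := ⟨i₀, by simp [hi₀, hbi₀]⟩
  obtain ⟨i, hi, hmin⟩ := Finset.exists_min_image _ (fun i => a i / -b i) hne
  rw [Finset.mem_filter] at hi
  have hi0 : 0 < -b i := by linarith [hi.2]
  refine ⟨a i / -b i, div_nonneg (ha i hi.1) hi0.le, fun j hj => ?_, i, hi.1, hi.2, ?_⟩
  · by_cases hbj : b j < 0
    · have h1 := hmin j (by simp [hj, hbj])
      have hj0 : 0 < -b j := by linarith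
      rw [le_div_iff₀ hj0] at h1
      linarith
    · have := mul_nonneg (div_nonneg (ha i hi.1) hi0.le) (not_lt.1 hbj)
      linarith [ha j hj]
  · have hi1 : b i ≠ 0 := hi.2.ne
    field_simp
    ring

/-- Moving along a circulation-like direction until an edge vanishes or a nontrivial odd cut
becomes tight. -/
theorem exists_perturbation {S T : Finset W} (hT : T ⊆ S) (hTe : Even T.card) {c y z : W → W → ℝ}
    (hy : FracJoin S T y) (hzs : ∀ u v, z u v = z v u) (hz0 : ∀ u v, y u v = 0 → z u v = 0)
    (hzS : ∀ u v, z u v ≠ 0 → u ∈ S) (hzT : ∀ v ∈ T, ∑ w ∈ S, z v w = 0)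
    (hcz : ∑ u ∈ S, ∑ w ∈ S, c u w * z u w ≤ 0) (hneg : ∃ a b, z a b < 0) :
    ∃ y', FracJoin S T y' ∧
      ∑ u ∈ S, ∑ w ∈ S, c u w * y' u w ≤ ∑ u ∈ S, ∑ w ∈ S, c u w * y u w ∧
      (∀ u v, y u v = 0 → y' u v = 0) ∧
      ((∃ a ∈ S, ∃ b ∈ S, y a b ≠ 0 ∧ y' a b = 0) ∨
        ∃ U ⊆ S, Odd (U ∩ T).card ∧ 2 ≤ U.card ∧ 2 ≤ (S \ U).card ∧
          ∑ u ∈ U, ∑ w ∈ S \ U, y' u w = 1) := by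
  classical
  -- The constraints watched during the move are nonnegativity of the entries and the odd cuts, the
  -- latter measured by their slack over 1.
  set I : Finset ((W × W) ⊕ Finset W) :=
    (S ×ˢ S).disjSum (S.powerset.filter fun U => Odd (U ∩ T).card) with hI
  set a : (W × W) ⊕ Finset W → ℝ := Sum.elim (fun p => y p.1 p.2)
    (fun U => ∑ u ∈ U, ∑ w ∈ S \ U, y u w - 1) with ha
  set b : (W × W) ⊕ Finset W → ℝ := Sum.elim (fun p => z p.1 p.2)
    (fun U => ∑ u ∈ U, ∑ w ∈ S \ U, z u w) with hb
  have hzS' : ∀ u v, z u v ≠ 0 → v ∈ S := fun u v h => hzS v u (by rwa [hzs])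
  obtain ⟨ε, hε, hpos, i, hi, hbi, hai⟩ := exists_max_step I a b
    (by
      rintro (p | U) hp
      · exact hy.nonneg _ _
      · simp only [hI, Finset.inr_mem_disjSum, Finset.mem_filter, Finset.mem_powerset] at hp
        exact sub_nonneg.2 (hy.oddCut U hp.1 hp.2))
    (by
      obtain ⟨u, v, huv⟩ := hneg
      exact ⟨Sum.inl (u, v), by simp [hI, hzS u v huv.ne, hzS' u v huv.ne], huv⟩)
  have hdiag : ∀ u, z u u = 0 := fun u => hz0 u u (hy.diag u)
  have hcut : ∀ U : Finset W, ∑ u ∈ U, ∑ w ∈ S \ U, (y u w + ε * z u w)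
      = ∑ u ∈ U, ∑ w ∈ S \ U, y u w + ε * ∑ u ∈ U, ∑ w ∈ S \ U, z u w := fun U => by
    simp only [Finset.sum_add_distrib, Finset.mul_sum]
  refine ⟨fun u w => y u w + ε * z u w, ⟨?_, ?_, ?_, ?_⟩, ?_, ?_, ?_⟩
  · intro u v; simp only [hy.symm u v, hzs u v]
  · intro u; simp [hy.diag, hdiag]
  · intro u v
    by_cases h : z u v = 0
    · simpa [h] using hy.nonneg u v
    · exact hpos (Sum.inl (u, v)) (by simp [hI, hzS u v h, hzS' u v h])
  · intro U hU hodd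
    have h := hpos (Sum.inr U) (by simp [hI, hU, hodd])
    simp only [ha, hb, Sum.elim_inr] at h
    rw [hcut]; linarith
  · have : ∑ u ∈ S, ∑ w ∈ S, c u w * (y u w + ε * z u w)
        = ∑ u ∈ S, ∑ w ∈ S, c u w * y u w + ε * ∑ u ∈ S, ∑ w ∈ S, c u w * z u w := by
      simp only [Finset.mul_sum, ← Finset.sum_add_distrib]
      exact Finset.sum_congr rfl fun u _ => Finset.sum_congr rfl fun w _ => by ring
    rw [this]
    have := mul_nonpos_of_nonneg_of_nonpos hε hcz
    linarith
  · intro u v h; simp [h, hz0 u v h]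
  · rcases i with p | U
    · left
      simp only [hI, Finset.inl_mem_disjSum, Finset.mem_product] at hi
      refine ⟨p.1, hi.1, p.2, hi.2, fun h => ?_, hai⟩
      have : z p.1 p.2 < 0 := hbi
      exact this.ne (hz0 _ _ h)
    · right
      simp only [hI, Finset.inr_mem_disjSum, Finset.mem_filter, Finset.mem_powerset] at hi
      obtain ⟨hU, hodd⟩ := hi
      simp only [ha, hb, Sum.elim_inr] at hbi hai
      -- An odd singleton is a node of `T`, where `z` sums to zero, so its cut cannot decrease.
      -- Applied to `U` and to its complement, this makes the new tight cut nontrivial.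
      have hone : ∀ X ⊆ S, Odd (X ∩ T).card → ∑ u ∈ X, ∑ w ∈ S \ X, z u w < 0 → 2 ≤ X.card := by
        intro X hX hXodd hXneg
        by_contra hlt
        have h1 : (X ∩ T).card ≤ X.card := Finset.card_le_card Finset.inter_subset_left
        have h2 : 0 < (X ∩ T).card := hXodd.pos
        obtain ⟨v, rfl⟩ := Finset.card_eq_one.1 (show X.card = 1 by omega)
        obtain ⟨v', hv'⟩ := Finset.card_pos.1 h2
        rw [Finset.mem_inter, Finset.mem_singleton] at hv'
        obtain ⟨rfl, hvT⟩ := hv'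
        rw [Finset.sum_singleton, Finset.sdiff_singleton_eq_erase] at hXneg
        have := Finset.add_sum_erase S (fun w => z v' w) (hT hvT)
        rw [hzT _ hvT, hdiag] at this
        linarith
      refine ⟨U, hU, hodd, hone U hU hodd hbi, hone _ Finset.sdiff_subset
        (odd_sdiff_inter hT hTe hodd) ?_, ?_⟩
      · rw [cutSum_compl hU hzs]; exact hbi
      · rw [hcut]; linarith

/-- The support graph of `y` on the node set `S`. -/
def supportGraph (S : Finset W) (y : W → W → ℝ) (hs : ∀ u v, y u v = y v u)
    (hd : ∀ u, y u u = 0) : SimpleGraph W where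
  Adj u v := u ∈ S ∧ v ∈ S ∧ y u v ≠ 0
  symm := ⟨fun u v h => ⟨h.2.1, h.1, by rw [hs]; exact h.2.2⟩⟩
  loopless := ⟨fun u h => h.2.2 (hd u)⟩

open Classical in
/-- The symmetric matrix of an edge vector. -/
noncomputable def edgeMatrix (H : SimpleGraph W) (ζ : H.edgeSet → ℝ) (u w : W) : ℝ :=
  if h : H.Adj u w then ζ ⟨s(u, w), h⟩ else 0

omit [DecidableEq W] in
theorem edgeMatrix_symm (H : SimpleGraph W) (ζ : H.edgeSet → ℝ) (u w : W) :
    edgeMatrix H ζ u w = edgeMatrix H ζ w u := by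
  unfold edgeMatrix
  by_cases h : H.Adj u w
  · rw [dif_pos h, dif_pos h.symm]
    congr 2
    exact Sym2.eq_swap
  · rw [dif_neg h, dif_neg (fun h' => h h'.symm)]

/-- The node sums over `S` of an edge vector, at the nodes of `T`. -/
noncomputable def nodeSum (H : SimpleGraph W) (S T : Finset W) :
    (H.edgeSet → ℝ) →ₗ[ℝ] (T → ℝ) where
  toFun ζ v := ∑ w ∈ S, edgeMatrix H ζ v w
  map_add' ζ ξ := by
    ext v
    simp only [Pi.add_apply, ← Finset.sum_add_distrib]
    refine Finset.sum_congr rfl fun w _ => ?_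
    unfold edgeMatrix; split_ifs <;> simp
  map_smul' a ζ := by
    ext v
    simp only [Pi.smul_apply, smul_eq_mul, RingHom.id_apply, Finset.mul_sum]
    refine Finset.sum_congr rfl fun w _ => ?_
    unfold edgeMatrix; split_ifs <;> simp

/-- If a fractional `T`-join has no leaf in `T` and cannot be perturbed, then `T` is empty. -/
theorem eq_empty_of_rigid [Fintype W] {S T : Finset W} (hT : T ⊆ S) {y : W → W → ℝ}
    (hy : FracJoin S T y)
    (hleaf : ∀ v ∈ T, ∀ u ∈ S, v ≠ u → ∃ w ∈ S, w ≠ u ∧ y v w ≠ 0)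
    (hrigid : ∀ z : W → W → ℝ, (∀ u v, z u v = z v u) → (∀ u v, y u v = 0 → z u v = 0) →
      (∀ u v, z u v ≠ 0 → u ∈ S) → (∀ v ∈ T, ∑ w ∈ S, z v w = 0) → ∀ u v, z u v = 0) :
    T = ∅ := by
  classical
  by_contra hne
  set H := supportGraph S y hy.symm hy.diag with hH
  have hadj : ∀ u v, H.Adj u v ↔ u ∈ S ∧ v ∈ S ∧ y u v ≠ 0 := fun u v => Iff.rfl
  -- A kernel element of `nodeSum` is an admissible direction, hence zero; so the support has at
  -- most `T.card` edges.
  have hinj : Function.Injective (nodeSum H S T) := by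
    rw [← LinearMap.ker_eq_bot, LinearMap.ker_eq_bot']
    intro ζ hζ
    have hz := hrigid (edgeMatrix H ζ) (edgeMatrix_symm H ζ)
      (fun u v h => dif_neg fun h' => ((hadj u v).1 h').2.2 h)
      (fun u v h => by
        by_contra hu
        exact h (dif_neg fun h' => hu ((hadj u v).1 h').1))
      (fun v hv => congrFun hζ ⟨v, hv⟩)
    ext ⟨e, he⟩
    induction e using Sym2.ind with
    | _ u v =>
      have := hz u v
      rw [edgeMatrix, dif_pos (show H.Adj u v from he)] at this
      exact this
  have hcard : Fintype.card H.edgeSet ≤ T.card := by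
    have := LinearMap.finrank_le_finrank_of_injective hinj
    simpa [Module.finrank_fintype_fun_eq_card] using this
  have hdeg2 : ∀ v ∈ T, 2 ≤ H.degree v := by
    intro v hv
    have hcut := hy.oddCut {v} (by simpa using hT hv) (by
      rw [Finset.inter_comm, Finset.inter_singleton_of_mem hv]; simp)
    rw [Finset.sum_singleton] at hcut
    obtain ⟨u, hu, hyu⟩ : ∃ u ∈ S \ {v}, y v u ≠ 0 := by
      by_contra! h
      rw [Finset.sum_eq_zero h] at hcut
      linarith
    rw [Finset.mem_sdiff, Finset.mem_singleton] at hu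
    obtain ⟨w, hw, hwu, hyw⟩ := hleaf v hv u hu.1 (Ne.symm hu.2)
    have hsub : ({u, w} : Finset W) ⊆ H.neighborFinset v := by
      intro x hx
      rw [Finset.mem_insert, Finset.mem_singleton] at hx
      rw [SimpleGraph.mem_neighborFinset, hadj]
      rcases hx with rfl | rfl
      · exact ⟨hT hv, hu.1, hyu⟩
      · exact ⟨hT hv, hw, hyw⟩
    have := Finset.card_le_card hsub
    rwa [Finset.card_pair hwu.symm, SimpleGraph.card_neighborFinset_eq_degree] at this
  have hhand := H.sum_degrees_eq_twice_card_edges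
  have hE : H.edgeFinset.card = Fintype.card H.edgeSet := SimpleGraph.edgeFinset_card
  have hsplit : ∑ v ∈ T, H.degree v + ∑ v ∈ Tᶜ, H.degree v = ∑ v, H.degree v :=
    Finset.sum_add_sum_compl T _
  have hTsum : T.card * 2 ≤ ∑ v ∈ T, H.degree v := by
    rw [← smul_eq_mul]; exact Finset.card_nsmul_le_sum _ _ _ hdeg2
  -- Equality holds throughout 2|T| ≤ ∑ deg over `T` ≤ ∑ deg = 2|E| ≤ 2|T|: nodes of `T` have degree
  -- exactly 2, other nodes degree 0.
  have hout : ∀ v ∉ T, H.degree v = 0 := fun v hv =>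
    Finset.sum_eq_zero_iff.1 (show ∑ v ∈ Tᶜ, H.degree v = 0 by omega) v (by simpa using hv)
  have htwo : ∀ v ∈ T, H.degree v = 2 := by
    have h1 : ∑ v ∈ T, 2 = ∑ v ∈ T, H.degree v := by
      rw [Finset.sum_const, smul_eq_mul]; omega
    exact fun v hv => ((Finset.sum_eq_sum_iff_of_le hdeg2).1 h1 v hv).symm
  have hadjT : ∀ u v, H.Adj u v → u ∈ T := by
    intro u v huv
    by_contra hu
    have h1 := hout u hu
    rw [← SimpleGraph.card_neighborFinset_eq_degree, Finset.card_eq_zero] at h1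
    have h2 : v ∈ H.neighborFinset u := by simpa using huv
    rw [h1] at h2
    simp at h2
  have hsurj : Function.Surjective (nodeSum H S T) := by
    refine (LinearMap.injective_iff_surjective_of_finrank_eq_finrank ?_).1 hinj
    rw [Module.finrank_fintype_fun_eq_card, Module.finrank_fintype_fun_eq_card, Fintype.card_coe]
    omega
  -- With a 2-coloring, node sums taken with sign `g` cancel along every edge. By surjectivity some
  -- edge vector has node sums `g` itself, and its signed total is |T| ≠ 0.
  have hncol : ¬ H.Colorable 2 := by
    rintro ⟨C⟩
    set g : W → ℝ := fun v => if C v = 0 then 1 else -1 with hg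
    have hg1 : ∀ v, g v * g v = 1 := fun v => by simp only [hg]; split_ifs <;> norm_num
    have hgadj : ∀ u v, H.Adj u v → g u = - g v := by
      intro u v huv
      have := C.valid huv
      simp only [hg]
      split_ifs with h1 h2 h2
      · exact absurd (h1.trans h2.symm) this
      · norm_num
      · norm_num
      · omega
    obtain ⟨ζ, hζ⟩ := hsurj (fun v => g v)
    have h1 : ∀ v ∈ T, ∑ w ∈ T, edgeMatrix H ζ v w = g v := by
      intro v hv
      rw [← congrFun hζ ⟨v, hv⟩]
      refine Finset.sum_subset hT fun w _ hw => ?_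
      exact dif_neg fun h => hw (hadjT w v h.symm)
    have h2 : ∑ v ∈ T, ∑ w ∈ T, g v * edgeMatrix H ζ v w = T.card := by
      simp only [← Finset.mul_sum]
      rw [Finset.sum_congr rfl fun v hv => by rw [h1 v hv, hg1 v]]
      simp
    have h3 : ∑ v ∈ T, ∑ w ∈ T, g v * edgeMatrix H ζ v w
        = - ∑ v ∈ T, ∑ w ∈ T, g v * edgeMatrix H ζ v w := by
      conv_lhs => rw [Finset.sum_comm]
      rw [← Finset.sum_neg_distrib]
      refine Finset.sum_congr rfl fun w _ => ?_
      rw [← Finset.sum_neg_distrib]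
      refine Finset.sum_congr rfl fun v _ => ?_
      by_cases h : H.Adj v w
      · rw [hgadj v w h, edgeMatrix_symm]; ring
      · have e1 : edgeMatrix H ζ v w = 0 := dif_neg h
        have e2 : edgeMatrix H ζ w v = 0 := dif_neg fun h' => h h'.symm
        rw [e1, e2]; ring
    have h4 : (0 : ℝ) < T.card := by exact_mod_cast Finset.card_pos.2 (Finset.nonempty_iff_ne_empty.2 hne)
    linarith
  obtain ⟨u, p, hp, hodd⟩ : ∃ u, ∃ p : H.Walk u u, p.IsCycle ∧ Odd p.length := by
    by_contra! h
    exact hncol (colorable_two_of_forall_cycle_even H fun u p hp =>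
      Nat.not_odd_iff_even.1 (h u p hp))
  have hsupp : ∀ a ∈ p.support, a ∈ T := by
    intro a ha
    have h2 := hp.ncard_neighborSet_toSubgraph_eq_two ha
    obtain ⟨b, hb⟩ : (p.toSubgraph.neighborSet a).Nonempty := by
      rw [Set.nonempty_iff_ne_empty]; intro h; rw [h] at h2; simp at h2
    exact hadjT a b (SimpleGraph.Subgraph.Adj.adj_sub hb)
  have hsub : p.support.toFinset ⊆ T := fun a ha => hsupp a (List.mem_toFinset.1 ha)
  -- All nodes of the odd cycle lie in `T` and have degree 2, so no support edge leaves it: an odd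
  -- cut of value 0.
  have hcut := hy.oddCut p.support.toFinset (hsub.trans hT) (by
    rw [Finset.inter_eq_left.2 hsub, card_support_toFinset_of_isCycle hp]; exact hodd)
  rw [Finset.sum_eq_zero fun a ha => Finset.sum_eq_zero fun b hb => ?_] at hcut
  · linarith
  · rw [Finset.mem_sdiff] at hb
    by_contra hab
    have ha' := List.mem_toFinset.1 ha
    refine hb.2 (List.mem_toFinset.2 (mem_support_of_adj_of_degree_two H hp ha'
      (htwo a (hsupp a ha')) ((hadj a b).2 ⟨hT (hsub ha), hb.1, hab⟩)))

theorem joinDominates [Fintype W] (S : Finset W) : JoinDominates S := by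
  classical
  induction hn : S.card using Nat.strong_induction_on generalizing S with
  | _ n ih =>
  have ihS : ∀ S' : Finset W, S'.card < S.card → JoinDominates S' :=
    fun S' h => ih _ (hn ▸ h) S' rfl
  intro T hT hTe c hcs hc y hy B hB
  -- The inner induction on the support size absorbs the moves that only kill an edge.
  induction hm : ((S ×ˢ S).filter fun p => y p.1 p.2 ≠ 0).card using Nat.strong_induction_on
    generalizing y with
  | _ m ihm =>
  have hnn : ∀ z : W → W → ℝ, (∀ u v, 0 ≤ z u v) → 0 ≤ ∑ u ∈ S, ∑ w ∈ S, c u w * z u w :=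
    fun z hz => Finset.sum_nonneg fun u _ => Finset.sum_nonneg fun w _ =>
      mul_nonneg (hc u w) (hz u w)
  rcases T.eq_empty_or_nonempty with rfl | hTne
  · have h1 := hB 0 .nil
    have h2 := hnn y hy.nonneg
    linarith
  by_cases hleaf : ∀ v ∈ T, ∀ u ∈ S, v ≠ u → ∃ w ∈ S, w ≠ u ∧ y v w ≠ 0
  swap
  · push Not at hleaf
    obtain ⟨v, hv, u, hu, hvu, h⟩ := hleaf
    exact le_of_leaf (ihS _ (Finset.card_erase_lt_of_mem (hT hv))) hT hTe hcs hc hy hv hu hvu h hB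
  obtain ⟨z, hzs, hz0, hzS, hzT, a, b, hab⟩ : ∃ z : W → W → ℝ, (∀ u v, z u v = z v u) ∧
      (∀ u v, y u v = 0 → z u v = 0) ∧ (∀ u v, z u v ≠ 0 → u ∈ S) ∧
      (∀ v ∈ T, ∑ w ∈ S, z v w = 0) ∧ ∃ a b, z a b ≠ 0 := by
    by_contra! h
    exact hTne.ne_empty (eq_empty_of_rigid hT hy hleaf h)
  obtain ⟨z', hzs', hz0', hzS', hzT', hcz', hneg'⟩ : ∃ z : W → W → ℝ, (∀ u v, z u v = z v u) ∧
      (∀ u v, y u v = 0 → z u v = 0) ∧ (∀ u v, z u v ≠ 0 → u ∈ S) ∧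
      (∀ v ∈ T, ∑ w ∈ S, z v w = 0) ∧ (∑ u ∈ S, ∑ w ∈ S, c u w * z u w ≤ 0) ∧
      ∃ a b, z a b < 0 := by
    -- One of `z` and `-z` qualifies: since `c ≥ 0`, a direction of negative cost has a negative
    -- entry, and a direction with no positive entry has cost at most 0.
    by_cases h : (∑ u ∈ S, ∑ w ∈ S, c u w * z u w ≤ 0) ∧ ∃ a b, z a b < 0
    · exact ⟨z, hzs, hz0, hzS, hzT, h⟩
    have hpos : ∑ u ∈ S, ∑ w ∈ S, c u w * -z u w = -∑ u ∈ S, ∑ w ∈ S, c u w * z u w := by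
      simp only [mul_neg, Finset.sum_neg_distrib]
    refine ⟨fun u v => -z u v, fun u v => neg_inj.2 (hzs u v), fun u v h => by simp [hz0 u v h],
      fun u v h => hzS u v (by simpa using h), fun v hv => by
        rw [Finset.sum_neg_distrib, hzT v hv, neg_zero], ?_, ?_⟩
    · rw [hpos]
      by_contra hlt
      have hc0 : ∑ u ∈ S, ∑ w ∈ S, c u w * z u w < 0 := by linarith
      have : ∀ u v, 0 ≤ z u v := by
        by_contra! h'
        exact h ⟨hc0.le, h'⟩
      linarith [hnn z this]
    · by_contra! h'
      have hle : ∀ u v, z u v ≤ 0 := fun u v => by linarith [h' u v]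
      refine h ⟨?_, a, b, lt_of_le_of_ne (hle a b) hab⟩
      have := hnn _ h'
      linarith
  obtain ⟨y', hy', hcy, hsupp, h⟩ := exists_perturbation hT hTe hy hzs' hz0' hzS' hzT' hcz' hneg'
  rcases h with ⟨u, hu, v, hv, huv, huv'⟩ | ⟨U, hU, hodd, hU2, hU2', htight⟩
  · refine (ihm _ ?_ y' hy' rfl).trans hcy
    rw [← hm]
    refine Finset.card_lt_card (Finset.ssubset_iff_of_subset ?_ |>.2 ⟨(u, v), ?_, ?_⟩)
    · intro p hp
      rw [Finset.mem_filter] at hp ⊢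
      exact ⟨hp.1, fun h => hp.2 (hsupp _ _ h)⟩
    · simp [hu, hv, huv]
    · simp [huv']
  · exact (le_of_tight_oddCut ihS hT hTe hcs hc hy' hU hodd hU2 hU2' htight hB).trans hcy

end Dominance

/-! ### Sums over cuts and edge sets as double sums -/

section EdgeSums

open scoped Classical

variable {V : Type*} [Fintype V]

theorem mem_cut_mk {G : SimpleGraph V} {U : Finset V} {a b : V} :
    s(a, b) ∈ cut G U ↔ G.Adj a b ∧ ¬ (a ∈ U ↔ b ∈ U) := by
  simp only [cut, Finset.mem_filter, SimpleGraph.mem_edgeFinset, SimpleGraph.mem_edgeSet]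
  refine and_congr_right fun _ => ⟨?_, fun h => ?_⟩
  · rintro ⟨u, v, hu, hv, h⟩
    rcases Sym2.eq_iff.1 h with ⟨rfl, rfl⟩ | ⟨rfl, rfl⟩ <;> simp [hu, hv]
  · by_cases ha : a ∈ U
    · exact ⟨a, b, ha, fun hb => h (by simp [ha, hb]), rfl⟩
    · exact ⟨b, a, by by_contra hb; exact h (by simp [ha, hb]), ha, Sym2.eq_swap⟩

theorem mem_edgesIn_mk {G : SimpleGraph V} {U : Finset V} {a b : V} :
    s(a, b) ∈ edgesIn G U ↔ G.Adj a b ∧ a ∈ U ∧ b ∈ U := by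
  simp [edgesIn]

theorem sum_cut_top (U : Finset V) (f : Sym2 V → ℝ) :
    ∑ e ∈ cut (⊤ : SimpleGraph V) U, f e = ∑ u ∈ U, ∑ w ∈ Finset.univ \ U, f s(u, w) := by
  rw [← Finset.sum_product']
  symm
  refine Finset.sum_bij (fun p _ => s(p.1, p.2)) ?_ ?_ ?_ (fun _ _ => rfl)
  · rintro ⟨a, b⟩ h
    simp only [Finset.mem_product, Finset.mem_sdiff, Finset.mem_univ, true_and] at h
    rw [mem_cut_mk, SimpleGraph.top_adj]
    exact ⟨fun hab : a = b => h.2 (hab ▸ h.1), by simp [h]⟩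
  · rintro ⟨a, b⟩ h ⟨a', b'⟩ h' heq
    simp only [Finset.mem_product, Finset.mem_sdiff, Finset.mem_univ, true_and] at h h'
    rcases Sym2.eq_iff.1 heq with ⟨h1, h2⟩ | ⟨h1, h2⟩
    · exact Prod.ext h1 h2
    · exact absurd (show b ∈ U from (show b = a' from h2) ▸ h'.1) h.2
  · intro e he
    obtain ⟨u, v, hu, hv, rfl⟩ := (Finset.mem_filter.1 he).2
    exact ⟨(u, v), by simp [hu, hv], rfl⟩

theorem two_mul_sum_edgeFinset {G : SimpleGraph V} (hG : G = ⊤) (f : Sym2 V → ℝ) :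
    2 * ∑ e ∈ G.edgeFinset, f e
      = ∑ u, ∑ w, if u = w then 0 else f s(u, w) := by
  have h1 : ∑ u : V, ∑ w : V, (if u = w then 0 else f s(u, w))
      = ∑ p ∈ (Finset.univ : Finset V).offDiag, f s(p.1, p.2) := by
    rw [← Finset.sum_product']
    symm
    refine Finset.sum_subset_zero_on_sdiff (fun p _ => by simp) (fun p hp => ?_) fun p hp => ?_
    · exact if_pos (by simpa using hp)
    · rw [if_neg (Finset.mem_offDiag.1 hp).2.2]
  rw [h1, ← Finset.sum_fiberwise_of_maps_to (t := G.edgeFinset)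
    (g := fun p : V × V => s(p.1, p.2)) (by rintro ⟨a, b⟩ h; simpa [hG] using h), Finset.mul_sum]
  refine Finset.sum_congr rfl fun e he => ?_
  induction e using Sym2.ind with
  | _ a b =>
    have hab : a ≠ b := by simpa [hG] using he
    have h2 : ((Finset.univ : Finset V).offDiag.filter fun p => s(p.1, p.2) = s(a, b))
        = {(a, b), (b, a)} := by
      ext ⟨u, v⟩
      simp only [Finset.mem_filter, Finset.mem_offDiag, Finset.mem_univ, true_and,
        Finset.mem_insert, Finset.mem_singleton, Prod.mk.injEq, Sym2.eq_iff]
      constructor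
      · exact fun h => h.2
      · rintro (⟨rfl, rfl⟩ | ⟨rfl, rfl⟩)
        · exact ⟨hab, Or.inl ⟨rfl, rfl⟩⟩
        · exact ⟨hab.symm, Or.inr ⟨rfl, rfl⟩⟩
    rw [h2, Finset.sum_pair (by simp [hab]), Sym2.eq_swap (a := b)]
    ring

theorem sum_edges_eq_add_cut (G : SimpleGraph V) (U : Finset V) (f : Sym2 V → ℝ) :
    ∑ e ∈ edgesIn G Finset.univ, f e
      = ∑ e ∈ edgesIn G U, f e + ∑ e ∈ edgesIn G Uᶜ, f e + ∑ e ∈ cut G U, f e := by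
  simp only [edgesIn, cut, Finset.sum_filter, ← Finset.sum_add_distrib]
  refine Finset.sum_congr rfl fun e he => ?_
  induction e using Sym2.ind with
  | _ a b =>
    have hab : G.Adj a b := by simpa using he
    have hc : (∃ u v : V, u ∈ U ∧ v ∉ U ∧ s(a, b) = s(u, v)) ↔ ¬ (a ∈ U ↔ b ∈ U) := by
      have := mem_cut_mk (G := G) (U := U) (a := a) (b := b)
      simpa [cut, hab] using this
    simp only [hc]
    by_cases ha : a ∈ U <;> by_cases hb : b ∈ U <;> simp [ha, hb]

theorem edgesIn_univ (G : SimpleGraph V) : edgesIn G Finset.univ = G.edgeFinset := by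
  simp [edgesIn]

end EdgeSums

/-! ### From matrices back to multisets of edges -/

section Joins

open scoped Classical

variable {V : Type*} [Fintype V]

omit [Fintype V] in
theorem deg_cons (e : Sym2 V) (F : Multiset (Sym2 V)) (v : V) :
    deg (e ::ₘ F) v = deg F v + if v ∈ e then 1 else 0 := by
  unfold deg
  by_cases h : v ∈ e <;> simp [h]

omit [Fintype V] in
theorem deg_add (F F' : Multiset (Sym2 V)) (v : V) : deg (F + F') v = deg F v + deg F' v := by
  simp [deg]

omit [Fintype V] in
theorem deg_val (J : Finset (Sym2 V)) (v : V) : deg J.val v = (J.filter (v ∈ ·)).card := rfl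

omit [Fintype V] in
theorem cost_add (c : Sym2 V → ℝ) (F F' : Multiset (Sym2 V)) :
    cost c (F + F') = cost c F + cost c F' := by
  simp [cost]

omit [Fintype V] in
theorem cost_val (c : Sym2 V → ℝ) (J : Finset (Sym2 V)) : cost c J.val = ∑ e ∈ J, c e := rfl

/-- The edge costs as a symmetric matrix with zero diagonal. -/
noncomputable def edgeVec (c : Sym2 V → ℝ) (u v : V) : ℝ := if u = v then 0 else c s(u, v)

theorem JoinCost.exists_isJoin {c : Sym2 V → ℝ} {T : Finset V} {r : ℝ}
    (h : JoinCost Finset.univ (edgeVec c) T r) :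
    ∃ F, IsJoin (⊤ : SimpleGraph V) T F ∧ cost c F = r := by
  induction h with
  | nil => exact ⟨0, ⟨by simp, by simp [deg]⟩, by simp [cost]⟩
  | @cons T r u v hu hv huv _ ih =>
    obtain ⟨F, ⟨hF1, hF2⟩, rfl⟩ := ih
    refine ⟨s(u, v) ::ₘ F, ⟨?_, fun w => ?_⟩, ?_⟩
    · intro e he
      rcases Multiset.mem_cons.1 he with rfl | he
      · simpa using huv
      · exact hF1 e he
    · rw [deg_cons]
      by_cases hw : w = u ∨ w = v
      · have h1 : w ∈ s(u, v) := by simpa using hw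
        rw [if_pos h1, Nat.odd_add_one, hF2]
        simp [Finset.mem_symmDiff, hw]
      · have h1 : w ∉ s(u, v) := by simpa using hw
        rw [if_neg h1, add_zero, hF2]
        simp [Finset.mem_symmDiff, hw]
    · simp [cost, edgeVec, huv, add_comm]

omit [Fintype V] in
/-- Reducing multiplicities modulo two turns a join into a set of edges that is no more costly. -/
theorem IsJoin.exists_finset {c : Sym2 V → ℝ} {G : SimpleGraph V} (hc : ∀ e ∈ G.edgeSet, 0 ≤ c e)
    {T : Finset V} {F : Multiset (Sym2 V)} (hF : IsJoin G T F) :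
    ∃ M : Finset (Sym2 V), IsJoin G T M.val ∧ cost c M.val ≤ cost c F := by
  refine ⟨F.toFinset.filter fun e => Odd (F.count e), ⟨?_, fun v => ?_⟩, ?_⟩
  · intro e he
    rw [Finset.mem_val, Finset.mem_filter, Multiset.mem_toFinset] at he
    exact hF.1 e he.1
  · rw [← hF.2 v]
    have h1 : deg F v = ∑ e ∈ F.toFinset.filter (v ∈ ·), F.count e := by
      rw [deg, ← Multiset.toFinset_sum_count_eq, Multiset.toFinset_filter]
      refine Finset.sum_congr rfl fun e he => ?_
      exact Multiset.count_filter_of_pos (p := (v ∈ ·)) (Finset.mem_filter.1 he).2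
    rw [h1, Finset.odd_sum_iff_odd_card_odd, deg_val, Finset.filter_comm]
  · rw [cost_val, cost, Finset.sum_multiset_map_count, Finset.sum_filter]
    refine Finset.sum_le_sum fun e he => ?_
    have h0 := hc e (hF.1 e (Multiset.mem_toFinset.1 he))
    split_ifs with hodd
    · have h1 : (1 : ℝ) ≤ F.count e := by exact_mod_cast hodd.pos
      rw [nsmul_eq_mul]
      nlinarith
    · exact nsmul_nonneg h0 _

theorem exists_isMinCostJoin {c : Sym2 V → ℝ} (hc : ∀ e ∈ (⊤ : SimpleGraph V).edgeSet, 0 ≤ c e)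
    {T : Finset V} (hT : Even T.card) :
    ∃ M : Finset (Sym2 V), IsMinCostJoin (⊤ : SimpleGraph V) c T M.val := by
  obtain ⟨r, hr⟩ := JoinCost.exists_of_even (edgeVec c) _ T rfl (Finset.subset_univ _) hT
  obtain ⟨F, hF, -⟩ := hr.exists_isJoin
  -- Only finitely many edge sets compete once multiplicities are reduced, so a minimum is attained.
  obtain ⟨M₀, hM₀, -⟩ := hF.exists_finset hc
  obtain ⟨M, hM, hmin⟩ := Finset.exists_min_image
    (Finset.univ.filter fun M : Finset (Sym2 V) => IsJoin (⊤ : SimpleGraph V) T M.val)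
    (fun M => cost c M.val) ⟨M₀, by simpa using hM₀⟩
  refine ⟨M, (Finset.mem_filter.1 hM).2, fun F' hF' => ?_⟩
  obtain ⟨M', hM', hle⟩ := hF'.exists_finset hc
  exact (hmin M' (by simpa using hM')).trans hle

/-- A minimum-cost join costs at most as much as any fractional join. -/
theorem IsMinCostJoin.cost_le {c y : Sym2 V → ℝ}
    (hc : ∀ e ∈ (⊤ : SimpleGraph V).edgeSet, 0 ≤ c e) {T : Finset V} (hT : Even T.card)
    {M : Multiset (Sym2 V)} (hM : IsMinCostJoin (⊤ : SimpleGraph V) c T M)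
    (hy : IsFractionalJoin (⊤ : SimpleGraph V) T y) : cost c M ≤ lpCost (⊤ : SimpleGraph V) c y := by
  have hsymm : ∀ (f : Sym2 V → ℝ) (u v : V), edgeVec f u v = edgeVec f v u := by
    intro f u v
    simp only [edgeVec, eq_comm (a := u), Sym2.eq_swap (a := u)]
  have hnn : ∀ f : Sym2 V → ℝ, (∀ e ∈ (⊤ : SimpleGraph V).edgeSet, 0 ≤ f e) →
      ∀ u v, 0 ≤ edgeVec f u v := by
    intro f hf u v
    unfold edgeVec
    split_ifs with h
    · exact le_rfl
    · exact hf _ (by simpa using h)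
  have key := joinDominates Finset.univ T (Finset.subset_univ _) hT (edgeVec c) (hsymm c)
    (hnn c hc) (edgeVec y) ⟨hsymm y, fun u => by simp [edgeVec], hnn y hy.nonneg, fun U _ hU => by
      refine (hy.oddCut U hU).trans (le_of_eq ?_)
      rw [sum_cut_top]
      refine Finset.sum_congr rfl fun u hu => Finset.sum_congr rfl fun w hw => ?_
      rw [edgeVec, if_neg]
      exact fun h => (Finset.mem_sdiff.1 hw).2 (h ▸ hu)⟩ (cost c M)
    (fun r hr => by
      obtain ⟨F, hF, rfl⟩ := hr.exists_isJoin
      exact hM.2 F hF)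
  have h2 := two_mul_sum_edgeFinset (rfl : (⊤ : SimpleGraph V) = ⊤) fun e => c e * y e
  have h3 : ∑ u : V, ∑ w : V, edgeVec c u w * edgeVec y u w
      = ∑ u : V, ∑ w : V, if u = w then 0 else c s(u, w) * y s(u, w) :=
    Finset.sum_congr rfl fun u _ => Finset.sum_congr rfl fun w _ => by
      unfold edgeVec; split_ifs <;> simp
  rw [h3, ← h2] at key
  unfold lpCost
  linarith

end Joins

/-! ### Wrong-degree nodes and tree cuts -/

section Parity

open scoped Classical

variable {V : Type*} [Fintype V]

/-- Double counting: in the sum of degrees over `U`, an edge contributes an odd number exactly when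
one of its ends lies in `U`. -/
theorem odd_sum_deg_iff {G : SimpleGraph V} {J : Finset (Sym2 V)} (hJ : ∀ e ∈ J, e ∈ G.edgeSet)
    (U : Finset V) :
    Odd (U ∩ Finset.univ.filter fun v => Odd (deg J.val v)).card ↔ Odd (J ∩ cut G U).card := by
  have h1 : U ∩ Finset.univ.filter (fun v => Odd (deg J.val v))
      = U.filter fun v => Odd (deg J.val v) := by
    ext; simp
  have h2 : ∑ v ∈ U, deg J.val v = ∑ e ∈ J, (U.filter (· ∈ e)).card := by
    simp only [deg_val]
    exact Finset.sum_card_bipartiteAbove_eq_sum_card_bipartiteBelow (fun v (e : Sym2 V) => v ∈ e)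
  rw [h1, ← Finset.odd_sum_iff_odd_card_odd, h2, Finset.odd_sum_iff_odd_card_odd]
  have h3 : (J.filter fun e => Odd (U.filter (· ∈ e)).card) = J ∩ cut G U := by
    ext e
    rw [Finset.mem_filter, Finset.mem_inter]
    refine and_congr_right fun he => ?_
    have heG := hJ e he
    induction e using Sym2.ind with
    | _ a b =>
      have hab : G.Adj a b := heG
      rw [mem_cut_mk, ← odd_card_inter_pair U hab.ne]
      have : U.filter (· ∈ s(a, b)) = U ∩ {a, b} := by ext; simp
      rw [this]
      simp [hab]
  rw [h3]

theorem wrongDegree_eq (T : Finset V) (F : Multiset (Sym2 V)) :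
    wrongDegree T F = symmDiff T (Finset.univ.filter fun v => Odd (deg F v)) := by
  ext v
  simp only [wrongDegree, Finset.mem_filter, Finset.mem_univ, true_and, Finset.mem_symmDiff,
    Nat.not_odd_iff_even]
  tauto

theorem odd_inter_wrongDegree_iff {G : SimpleGraph V} {J : Finset (Sym2 V)}
    (hJ : ∀ e ∈ J, e ∈ G.edgeSet) (T U : Finset V) :
    Odd (U ∩ wrongDegree T J.val).card ↔ ¬ (Odd (U ∩ T).card ↔ Odd (J ∩ cut G U).card) := by
  rw [wrongDegree_eq, odd_card_inter_symmDiff, odd_sum_deg_iff hJ]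

theorem even_card_wrongDegree {G : SimpleGraph V} {J : Finset (Sym2 V)}
    (hJ : ∀ e ∈ J, e ∈ G.edgeSet) {T : Finset V} (hT : Even T.card) :
    Even (wrongDegree T J.val).card := by
  have h := odd_inter_wrongDegree_iff hJ T Finset.univ
  have hcut : cut G Finset.univ = ∅ := by simp [cut]
  rw [hcut, Finset.inter_empty, Finset.univ_inter, Finset.univ_inter] at h
  rw [← Nat.not_odd_iff_even] at hT ⊢
  rw [h]
  simp [hT]

theorem isJoin_add_of_wrongDegree {G : SimpleGraph V} {J : Finset (Sym2 V)}
    (hJ : ∀ e ∈ J, e ∈ G.edgeSet) {T : Finset V} {M : Multiset (Sym2 V)}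
    (hM : IsJoin G (wrongDegree T J.val) M) : IsJoin G T (J.val + M) := by
  refine ⟨fun e he => ?_, fun v => ?_⟩
  · rcases Multiset.mem_add.1 he with h | h
    · exact hJ e h
    · exact hM.1 e h
  · rw [deg_add, Nat.odd_add', hM.2 v]
    simp only [wrongDegree, Finset.mem_filter, Finset.mem_univ, true_and, ← Nat.not_odd_iff_even]
    tauto

theorem isConnectedJoin_add {G : SimpleGraph V} {J : Finset (Sym2 V)} (hJ : IsSpanningTree G J)
    {T : Finset V} {M : Multiset (Sym2 V)} (hM : IsJoin G (wrongDegree T J.val) M) :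
    IsConnectedJoin G T (J.val + M) := by
  refine ⟨isJoin_add_of_wrongDegree hJ.1 hM, hJ.2.connected.mono ?_⟩
  refine SimpleGraph.fromEdgeSet_mono fun e he => ?_
  exact Multiset.mem_add.2 (Or.inl he)

theorem IsSpanningTree.inter_cut_nonempty {G : SimpleGraph V} {J : Finset (Sym2 V)}
    (hJ : IsSpanningTree G J) {U : Finset V} (hU : U.Nonempty) (hU' : U ≠ Finset.univ) :
    (J ∩ cut G U).Nonempty := by
  obtain ⟨u, hu⟩ := hU
  obtain ⟨v, hv⟩ : ∃ v, v ∉ U := by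
    by_contra! h
    exact hU' (Finset.eq_univ_of_forall h)
  obtain ⟨p⟩ := hJ.2.connected.preconnected u v
  obtain ⟨d, -, hd1, hd2⟩ := p.exists_boundary_dart (U : Set V) (by simpa using hu)
    (by simpa using hv)
  have hd := d.adj
  rw [SimpleGraph.fromEdgeSet_adj] at hd
  have hdJ : s(d.fst, d.snd) ∈ J := hd.1
  refine ⟨s(d.fst, d.snd), Finset.mem_inter.2 ⟨hdJ, mem_cut_mk.2 ⟨hJ.1 _ hdJ, ?_⟩⟩⟩
  rw [Finset.mem_coe] at hd1 hd2
  simp [hd1, hd2]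

end Parity

/-! ### The fractional join from the linear program -/

section LP

open scoped Classical

variable {V : Type*} [Fintype V]

theorem IsLPFeasible.sum_edgesIn_le {G : SimpleGraph V} {T : Finset V} {x : Sym2 V → ℝ}
    (hx : IsLPFeasible G T x) {S : Finset V} (hS : S.Nonempty) :
    ∑ e ∈ edgesIn G S, x e ≤ (S.card : ℝ) - 1 := by
  by_cases hu : S = Finset.univ
  · rw [hu, hx.total]; simp
  by_cases h2 : 2 ≤ S.card
  · exact hx.subtour S hu h2
  · have hpos := Finset.card_pos.2 hS
    obtain ⟨a, rfl⟩ := Finset.card_eq_one.1 (show S.card = 1 by omega)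
    have : edgesIn G {a} = ∅ := by
      refine Finset.eq_empty_of_forall_notMem fun e => ?_
      induction e using Sym2.ind with
      | _ u v =>
        rw [mem_edgesIn_mk, Finset.mem_singleton, Finset.mem_singleton]
        rintro ⟨h, rfl, rfl⟩
        exact h.ne rfl
    simp [this]

/-- The two sides carry at most (|U| - 1) + (|V| - |U| - 1) = |V| - 2 of the total |V| - 1, leaving
1 for the cut. -/
theorem IsLPFeasible.one_le_sum_cut {G : SimpleGraph V} {T : Finset V} {x : Sym2 V → ℝ}
    (hx : IsLPFeasible G T x) {U : Finset V} (hU : U.Nonempty) (hU' : U ≠ Finset.univ) :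
    1 ≤ ∑ e ∈ cut G U, x e := by
  have h1 := sum_edges_eq_add_cut G U x
  have h2 := hx.sum_edgesIn_le hU
  have h3 := hx.sum_edgesIn_le (S := Uᶜ) (by
    rw [Finset.nonempty_iff_ne_empty, Ne, Finset.compl_eq_empty_iff]; exact hU')
  have h4 : (U.card : ℝ) + Uᶜ.card = Fintype.card V := by
    exact_mod_cast Finset.card_add_card_compl U
  rw [hx.total] at h1
  linarith

theorem sum_cut_incidence (G : SimpleGraph V) (J : Finset (Sym2 V)) (U : Finset V) :
    ∑ e ∈ cut G U, incidence J e = ((J ∩ cut G U).card : ℝ) := by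
  simp only [incidence, Finset.sum_ite_mem, Finset.sum_const, nsmul_eq_mul, mul_one]
  rw [Finset.inter_comm]

theorem IsLPFeasible.isFractionalJoin {G : SimpleGraph V} {T : Finset V} (hT : Even T.card)
    {x : Sym2 V → ℝ} (hx : IsLPFeasible G T x) {J : Finset (Sym2 V)} (hJ : IsSpanningTree G J) :
    IsFractionalJoin G (wrongDegree T J.val) fun e => 1 / 3 * incidence J e + 1 / 3 * x e := by
  refine ⟨fun U hodd => ?_, fun e he => ?_⟩
  · have hU : U.Nonempty := by
      rw [Finset.nonempty_iff_ne_empty]; rintro rfl; simp at hodd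
    have hU' : U ≠ Finset.univ := by
      rintro rfl
      rw [Finset.univ_inter] at hodd
      exact Nat.not_even_iff_odd.2 hodd (even_card_wrongDegree hJ.1 hT)
    rw [Finset.sum_add_distrib, ← Finset.mul_sum, ← Finset.mul_sum, sum_cut_incidence]
    have hpos := Finset.card_pos.2 (hJ.inter_cut_nonempty hU hU')
    rw [odd_inter_wrongDegree_iff hJ.1] at hodd
    -- The tree and `x` contribute at least 1 + 2 in the even case and 2 + 1 in the odd case.
    by_cases hUT : Even (U ∩ T).card
    · have h1 := hx.evenCut U hU hU' hUT
      have h2 : (1 : ℝ) ≤ (J ∩ cut G U).card := by exact_mod_cast hpos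
      linarith
    · rw [Nat.not_even_iff_odd] at hUT
      have h1 := hx.one_le_sum_cut hU hU'
      have h3 : Even (J ∩ cut G U).card := by
        rw [← Nat.not_odd_iff_even]; tauto
      have h2 : (2 : ℝ) ≤ (J ∩ cut G U).card := by
        have : 2 ≤ (J ∩ cut G U).card := by
          obtain ⟨k, hk⟩ := h3; omega
        exact_mod_cast this
      linarith
  · have h1 := hx.nonneg e he
    have h2 : 0 ≤ incidence J e := by unfold incidence; split_ifs <;> norm_num
    positivity

end LP

/-! ### Minimum spanning trees against the linear program -/

section Threshold

open scoped Classical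

variable {V : Type*} [Fintype V]

omit [Fintype V] in
theorem edgeSet_fromEdgeSet_of_subset {G : SimpleGraph V} {J : Finset (Sym2 V)}
    (hJ : ∀ e ∈ J, e ∈ G.edgeSet) :
    (SimpleGraph.fromEdgeSet (J : Set (Sym2 V))).edgeSet = J := by
  rw [SimpleGraph.edgeSet_fromEdgeSet, sdiff_eq_left, Set.disjoint_left]
  exact fun e he hd => G.not_isDiag_of_mem_edgeSet (hJ e he) hd

theorem IsSpanningTree.card_add_one {G : SimpleGraph V} {J : Finset (Sym2 V)}
    (hJ : IsSpanningTree G J) : J.card + 1 = Fintype.card V := by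
  have h := (SimpleGraph.isTree_iff_connected_and_card.1 hJ.2).2
  rw [edgeSet_fromEdgeSet_of_subset hJ.1, Nat.card_eq_fintype_card, Nat.card_eq_fintype_card] at h
  simpa using h

/-- In a minimum spanning tree, the path between the ends of an edge uses no costlier edges. -/
theorem IsMinSpanningTree.cost_le_of_mem_path {G : SimpleGraph V} {c : Sym2 V → ℝ}
    {J : Finset (Sym2 V)} (hJ : IsMinSpanningTree G c J) {u v : V} (huv : G.Adj u v)
    {H : SimpleGraph V} (hH : H = SimpleGraph.fromEdgeSet (J : Set (Sym2 V)))
    {p : H.Walk v u} (hp : p.IsPath) {e : Sym2 V}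
    (he : e ∈ p.edges) : c e ≤ c s(u, v) := by
  obtain ⟨⟨hJG, hJt⟩, hmin⟩ := hJ
  have hHe : H.edgeSet = J := hH ▸ edgeSet_fromEdgeSet_of_subset hJG
  have hHt : H.IsTree := hH ▸ hJt
  have heJ : e ∈ J := by
    have := p.edges_subset_edgeSet he
    rwa [hHe] at this
  by_contra! hlt
  by_cases hf : s(u, v) ∈ J
  · have hadj : H.Adj v u := by
      rw [← SimpleGraph.mem_edgeSet, hHe, Sym2.eq_swap]; exact hf
    have h1 : p = hadj.toWalk :=
      congrArg Subtype.val ((hHt.isAcyclic.subsingleton_path v u).elim ⟨p, hp⟩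
        (SimpleGraph.Path.singleton hadj))
    rw [h1] at he
    have h2 : e = s(v, u) := by simpa using he
    rw [h2, Sym2.eq_swap] at hlt
    exact lt_irrefl _ hlt
  set J' : Finset (Sym2 V) := insert s(u, v) (J.erase e) with hJ'
  have hJ'G : ∀ a ∈ J', a ∈ G.edgeSet := by
    intro a ha
    rcases Finset.mem_insert.1 ha with rfl | ha
    · exact huv
    · exact hJG a (Finset.mem_of_mem_erase ha)
  have hcost : cost c J'.val = c s(u, v) + (cost c J.val - c e) := by
    rw [cost_val, cost_val, hJ', Finset.sum_insert fun h => hf (Finset.mem_of_mem_erase h),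
      ← Finset.add_sum_erase J c heJ]
    ring
  have hconn : (SimpleGraph.fromEdgeSet (J' : Set (Sym2 V))).Connected := by
    -- Exchange argument: in the tree plus `uv`, the edge `e` lies on a cycle, so deleting it keeps
    -- the graph connected.
    set K := H ⊔ SimpleGraph.edge u v with hK
    have hKc : K.Connected := hHt.connected.mono le_sup_left
    have huvK : K.Adj u v := Or.inr (by simp [SimpleGraph.edge_adj, huv.ne])
    have hcyc : ((p.mapLe (le_sup_left : H ≤ K)).cons huvK).IsCycle := by
      rw [SimpleGraph.Walk.cons_isCycle_iff]
      refine ⟨hp.mapLe _, fun h => hf ?_⟩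
      have h1 : s(u, v) ∈ p.edges := by simpa using h
      have := p.edges_subset_edgeSet h1
      rwa [hHe] at this
    have heK : e ∈ ((p.mapLe (le_sup_left : H ≤ K)).cons huvK).edges := by
      simp [he]
    have hnb : ¬ K.IsBridge e := fun hb =>
      (SimpleGraph.isBridge_iff_forall_cycle_notMem
        (SimpleGraph.Walk.edges_subset_edgeSet _ heK)).1 hb _ hcyc heK
    have hdel : (K.deleteEdges {e}).Connected :=
      Sym2.ind (f := fun e => ¬ K.IsBridge e → (K.deleteEdges {e}).Connected)
        (fun _ _ h => hKc.connected_delete_edge_of_not_isBridge h) e hnb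
    refine hdel.mono fun a b hab => ?_
    rw [SimpleGraph.deleteEdges_adj] at hab
    obtain ⟨hab, habe⟩ := hab
    rw [SimpleGraph.fromEdgeSet_adj]
    refine ⟨?_, hab.ne⟩
    rw [hJ', Finset.mem_coe, Finset.mem_insert, Finset.mem_erase]
    rcases hab with hab | hab
    · refine Or.inr ⟨habe, ?_⟩
      have : s(a, b) ∈ H.edgeSet := hab
      rwa [hHe] at this
    · left
      rw [SimpleGraph.edge_adj] at hab
      exact Sym2.eq_iff.2 (by tauto)
  have htree : IsSpanningTree G J' := by
    refine ⟨hJ'G, SimpleGraph.isTree_iff_connected_and_card.2 ⟨hconn, ?_⟩⟩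
    have h1 := IsSpanningTree.card_add_one ⟨hJG, hJt⟩
    rw [edgeSet_fromEdgeSet_of_subset hJ'G, Nat.card_eq_fintype_card, Nat.card_eq_fintype_card, ← h1]
    have h2 : J'.card = J.card := by
      rw [hJ', Finset.card_insert_of_notMem fun h => hf (Finset.mem_of_mem_erase h),
        Finset.card_erase_of_mem heJ]
      have := Finset.card_pos.2 ⟨e, heJ⟩
      omega
    simpa using h2
  have := hmin J' htree
  linarith

/-- The edges inside the components of a graph `K` carry at most as much weight in a feasible
solution as `K` has edges. -/
theorem IsLPFeasible.sum_within_components_le {G : SimpleGraph V} {T : Finset V} {x : Sym2 V → ℝ}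
    (hx : IsLPFeasible G T x) (K : SimpleGraph V) :
    ∑ e ∈ G.edgeFinset.filter (fun e => ∃ C : K.ConnectedComponent, ∀ v ∈ e,
      K.connectedComponentMk v = C), x e ≤ ((edgesIn K Finset.univ).card : ℝ) := by
  set comp : K.ConnectedComponent → Finset V :=
    fun C => Finset.univ.filter fun v => K.connectedComponentMk v = C with hcomp
  have hdisj : ∀ F : SimpleGraph V, Set.PairwiseDisjoint (Finset.univ : Finset K.ConnectedComponent)
      (fun C => edgesIn F (comp C)) := by
    intro F C _ C' _ hne
    refine Finset.disjoint_left.2 fun e => ?_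
    induction e using Sym2.ind with
    | _ a b =>
      rw [mem_edgesIn_mk, mem_edgesIn_mk]
      rintro ⟨-, h1, -⟩ ⟨-, h2, -⟩
      simp only [hcomp, Finset.mem_filter, Finset.mem_univ, true_and] at h1 h2
      exact hne (h1.symm.trans h2)
  have hunion : G.edgeFinset.filter (fun e => ∃ C : K.ConnectedComponent, ∀ v ∈ e,
      K.connectedComponentMk v = C) = Finset.univ.biUnion fun C => edgesIn G (comp C) := by
    ext e
    simp [edgesIn, hcomp]
  rw [hunion, Finset.sum_biUnion (hdisj G)]
  have hC : ∀ C : K.ConnectedComponent,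
      ∑ e ∈ edgesIn G (comp C), x e ≤ ((edgesIn K (comp C)).card : ℝ) := by
    intro C
    obtain ⟨v, hv⟩ := C.nonempty_supp
    have hne : (comp C).Nonempty := ⟨v, by simpa [hcomp] using hv⟩
    refine (hx.sum_edgesIn_le hne).trans ?_
    -- A connected graph on |C| nodes has at least |C| - 1 edges, which is the subtour bound for
    -- `C`.
    have h1 := C.connected_toSimpleGraph.card_vert_le_card_edgeSet_add_one
    have h2 : Nat.card C = (comp C).card := by
      rw [Nat.card_eq_fintype_card]
      exact Fintype.card_of_subtype _ fun v => by
        simp only [hcomp, Finset.mem_filter, Finset.mem_univ, true_and]; exact Iff.rfl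
    have h3 : Nat.card C.toSimpleGraph.edgeSet ≤ (edgesIn K (comp C)).card := by
      rw [← Fintype.card_coe (edgesIn K (comp C)), ← Nat.card_eq_fintype_card]
      refine Nat.card_le_card_of_injective (fun e => ⟨Sym2.map Subtype.val e.1, ?_⟩) ?_
      · obtain ⟨e, he⟩ := e
        induction e using Sym2.ind with
        | _ a b =>
          have hab : K.Adj a b := he
          exact mem_edgesIn_mk.2 ⟨hab, Finset.mem_filter.2 ⟨Finset.mem_univ _, a.2⟩,
            Finset.mem_filter.2 ⟨Finset.mem_univ _, b.2⟩⟩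
      · intro e e' h
        exact Subtype.ext (Sym2.map.injective Subtype.val_injective (congrArg Subtype.val h))
    have h4 : (comp C).card ≤ (edgesIn K (comp C)).card + 1 := by omega
    have h5 : ((comp C).card : ℝ) ≤ (edgesIn K (comp C)).card + 1 := by exact_mod_cast h4
    linarith
  refine (Finset.sum_le_sum fun C _ => hC C).trans ?_
  rw [← Nat.cast_sum, ← Finset.card_biUnion fun C _ C' _ h =>
    hdisj K (Finset.mem_coe.2 (Finset.mem_univ C)) (Finset.mem_coe.2 (Finset.mem_univ C')) h]
  refine Nat.cast_le.2 (Finset.card_le_card fun e he => ?_)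
  obtain ⟨C, -, he⟩ := Finset.mem_biUnion.1 he
  rw [edgesIn_univ]
  exact (Finset.mem_filter.1 he).1

/-- Summation by level sets. -/
theorem sum_mul_nonneg_of_levels {ι : Type*} (w : ι → ℝ) (s : Finset ι) (c : ι → ℝ)
    (hc : ∀ e ∈ s, 0 ≤ c e) (h : ∀ t, 0 ≤ ∑ e ∈ s.filter (fun e => t < c e), w e) :
    0 ≤ ∑ e ∈ s, c e * w e := by
  induction hn : s.card using Nat.strong_induction_on generalizing s c with
  | _ n ih =>
  rcases s.eq_empty_or_nonempty with rfl | hne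
  · simp
  obtain ⟨a, ha, hmin⟩ := Finset.exists_min_image s c hne
  set s' := s.filter (fun e => c a < c e) with hs'
  have h1 : ∑ e ∈ s, c e * w e = c a * ∑ e ∈ s, w e + ∑ e ∈ s', (c e - c a) * w e := by
    have : ∑ e ∈ s', (c e - c a) * w e = ∑ e ∈ s, (c e - c a) * w e := by
      refine Finset.sum_subset (Finset.filter_subset _ _) fun e he he' => ?_
      have : c e = c a := le_antisymm (not_lt.1 fun h => he' (by simp [hs', he, h])) (hmin e he)
      rw [this]; ring
    rw [this, Finset.mul_sum, ← Finset.sum_add_distrib]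
    exact Finset.sum_congr rfl fun e _ => by ring
  have h2 : 0 ≤ ∑ e ∈ s, w e := by
    -- Any negative level selects all of `s`, as costs are nonnegative.
    have := h (-1)
    rwa [Finset.filter_true_of_mem fun e he => by linarith [hc e he]] at this
  have h3 : 0 ≤ ∑ e ∈ s', (c e - c a) * w e := by
    refine ih _ ?_ s' (fun e => c e - c a) (fun e he => ?_) (fun t => ?_) rfl
    · rw [← hn]
      exact Finset.card_lt_card ((Finset.ssubset_iff_of_subset (Finset.filter_subset _ _)).2
        ⟨a, ha, by simp⟩)
    · linarith [hmin e (Finset.mem_filter.1 he).1]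
    -- For `t < 0` the level set of the shifted costs is all of `s'`, as at level 0; hence the
    -- maximum.
    · have := h (max t 0 + c a)
      have heq : s'.filter (fun e => t < c e - c a) = s.filter (fun e => max t 0 + c a < c e) := by
        ext e
        simp only [hs', Finset.mem_filter, and_assoc]
        refine and_congr_right fun _ => ?_
        rw [← lt_sub_iff_add_lt, max_lt_iff, sub_pos]
        tauto
      rwa [heq]
  rw [h1]
  exact add_nonneg (mul_nonneg (hc a ha) h2) h3

theorem lpCost_incidence {G : SimpleGraph V} {c : Sym2 V → ℝ} {J : Finset (Sym2 V)}
    (hJ : ∀ e ∈ J, e ∈ G.edgeSet) : lpCost G c (incidence J) = cost c J.val := by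
  have hJE : J ⊆ G.edgeFinset := fun e he => by simpa using hJ e he
  simp only [lpCost, incidence, mul_ite, mul_one, mul_zero, Finset.sum_ite_mem]
  rw [Finset.inter_eq_right.2 hJE, cost_val]

theorem IsMinSpanningTree.cost_le_lpCost {G : SimpleGraph V} {c : Sym2 V → ℝ}
    (hc : ∀ e ∈ G.edgeSet, 0 ≤ c e) {J : Finset (Sym2 V)} (hJ : IsMinSpanningTree G c J)
    {T : Finset V} {x : Sym2 V → ℝ} (hx : IsLPFeasible G T x) : cost c J.val ≤ lpCost G c x := by
  have hJE : J ⊆ G.edgeFinset := fun e he => by simpa using hJ.1.1 e he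
  have hinc : ∀ P : Sym2 V → Prop, ∑ e ∈ G.edgeFinset.filter P, incidence J e
      = ((J.filter P).card : ℝ) := by
    intro P
    simp only [incidence, Finset.sum_ite_mem, Finset.sum_const, nsmul_eq_mul, mul_one]
    congr 2
    ext e
    simp only [Finset.mem_inter, Finset.mem_filter]
    exact ⟨fun h => ⟨h.2, h.1.2⟩, fun h => ⟨⟨hJE h.1, h.2⟩, h.1⟩⟩
  -- Since `x` and `J` have the same total |V| - 1, it is equivalent that on the edges of cost at
  -- most `t` the weight of `x` does not exceed the number of edges of `J`.
  have hlevel : ∀ t, 0 ≤ ∑ e ∈ G.edgeFinset.filter (fun e => t < c e), (x e - incidence J e) := by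
    intro t
    rw [Finset.sum_sub_distrib, hinc]
    have h1 : ∑ e ∈ G.edgeFinset.filter (fun e => t < c e), x e
        + ∑ e ∈ G.edgeFinset.filter (fun e => ¬ t < c e), x e = Fintype.card V - 1 := by
      rw [← hx.total, edgesIn_univ]
      convert Finset.sum_filter_add_sum_filter_not G.edgeFinset (fun e => t < c e) x
    have h2 : (J.filter fun e => t < c e).card + (J.filter fun e => ¬ t < c e).card = J.card :=
      Finset.card_filter_add_card_filter_not _
    have h3 : ((J.filter fun e => t < c e).card : ℝ) + (J.filter fun e => ¬ t < c e).card + 1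
        = Fintype.card V := by
      exact_mod_cast h2 ▸ hJ.1.card_add_one
    set Jt := J.filter fun e => ¬ t < c e with hJt
    have hJtG : ∀ e ∈ Jt, e ∈ G.edgeSet := fun e he => hJ.1.1 e (Finset.mem_filter.1 he).1
    obtain ⟨K, hK⟩ : ∃ K, K = SimpleGraph.fromEdgeSet (Jt : Set (Sym2 V)) := ⟨_, rfl⟩
    have hKe : edgesIn K Finset.univ = Jt := by
      ext e
      rw [edgesIn_univ, SimpleGraph.mem_edgeFinset, hK, edgeSet_fromEdgeSet_of_subset hJtG, Finset.mem_coe]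
    have h4 := hx.sum_within_components_le K
    rw [hKe] at h4
    have h5 : ∑ e ∈ G.edgeFinset.filter (fun e => ¬ t < c e), x e
        ≤ ∑ e ∈ G.edgeFinset.filter (fun e => ∃ C : K.ConnectedComponent, ∀ v ∈ e,
          K.connectedComponentMk v = C), x e := by
      refine Finset.sum_le_sum_of_subset_of_nonneg (fun e he => ?_) fun e he _ =>
        hx.nonneg e (by simpa using (Finset.mem_filter.1 he).1)
      rw [Finset.mem_filter] at he ⊢
      refine ⟨he.1, ?_⟩
      have heG : e ∈ G.edgeSet := by simpa using he.1
      have het := not_lt.1 he.2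
      induction e using Sym2.ind with
      | _ u v =>
        -- The tree path between the ends of an edge of cost at most `t` uses only edges of cost at
        -- most `t`, so it survives in `K`.
        obtain ⟨p, hp⟩ := (hJ.1.2.connected.preconnected v u).exists_isPath
        have hreach : K.Reachable v u := by
          refine ⟨p.transfer K fun e he => ?_⟩
          rw [hK, edgeSet_fromEdgeSet_of_subset hJtG, Finset.mem_coe, hJt, Finset.mem_filter]
          have h6 := p.edges_subset_edgeSet he
          rw [edgeSet_fromEdgeSet_of_subset hJ.1.1] at h6
          exact ⟨h6, not_lt.2 ((hJ.cost_le_of_mem_path heG rfl hp he).trans het)⟩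
        refine ⟨K.connectedComponentMk u, fun w hw => ?_⟩
        rcases Sym2.mem_iff.1 hw with rfl | rfl
        · rfl
        · exact SimpleGraph.ConnectedComponent.eq.2 hreach
    linarith
  have key := sum_mul_nonneg_of_levels (fun e => x e - incidence J e) G.edgeFinset c
    (fun e he => hc e (by simpa using he)) hlevel
  simp only [mul_sub, Finset.sum_sub_distrib] at key
  rw [← lpCost_incidence hJ.1.1]
  exact sub_nonneg.1 key

theorem exists_isMinSpanningTree {G : SimpleGraph V} (hG : G.Connected) (c : Sym2 V → ℝ) :
    ∃ J, IsMinSpanningTree G c J := by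
  obtain ⟨H, hHG, hH⟩ := hG.exists_isTree_le
  have hne : (Finset.univ.filter fun J : Finset (Sym2 V) => IsSpanningTree G J).Nonempty := by
    refine ⟨H.edgeFinset, ?_⟩
    rw [Finset.mem_filter]
    refine ⟨Finset.mem_univ _, fun e he => ?_, ?_⟩
    · exact SimpleGraph.edgeSet_mono hHG (by simpa using he)
    · rw [SimpleGraph.coe_edgeFinset, SimpleGraph.fromEdgeSet_edgeSet]; exact hH
  obtain ⟨J, hJ, hmin⟩ := Finset.exists_min_image _ (fun J => cost c J.val) hne
  exact ⟨J, (Finset.mem_filter.1 hJ).2, fun J' hJ' => hmin J' (by simpa using hJ')⟩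

end Threshold

end ConnTJoin

/-! ### The approximation guarantee -/

theorem mainTheorem2 {V : Type*} [Fintype V] [Nonempty V]
    (G : SimpleGraph V) (c : Sym2 V → ℝ) (hG : ConnTJoin.IsMetricGraph G c)
    (T : Finset V) (hT : Even T.card) :
    -- both steps of the algorithm can be carried out, the second one by a set `M` of edges
    (∃ J M : Finset (Sym2 V), ConnTJoin.IsChristofidesRun G c T J M.val) ∧
    -- whichever tree `J` and join `M` are chosen, the guarantee holds for `F = J + M`
    ∀ (J : Finset (Sym2 V)) (M : Multiset (Sym2 V)), ConnTJoin.IsChristofidesRun G c T J M →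
      ConnTJoin.IsConnectedJoin G T (J.val + M) ∧
      ∀ x : Sym2 V → ℝ, ConnTJoin.IsLPOptimal G c T x →
        ConnTJoin.IsFractionalJoin G (ConnTJoin.wrongDegree T J.val)
          (fun e => 1 / 3 * ConnTJoin.incidence J e + 1 / 3 * x e) ∧
        ConnTJoin.cost c (J.val + M) ≤ 5 / 3 * ConnTJoin.lpCost G c x := by
  obtain ⟨rfl, hc, -⟩ := hG
  refine ⟨?_, fun J M hJM => ⟨ConnTJoin.isConnectedJoin_add hJM.1.1 hJM.2.1, fun x hx => ?_⟩⟩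
  · obtain ⟨J, hJ⟩ := ConnTJoin.exists_isMinSpanningTree
      (SimpleGraph.connected_top (V := V)) c
    obtain ⟨M, hM⟩ := ConnTJoin.exists_isMinCostJoin hc (ConnTJoin.even_card_wrongDegree hJ.1.1 hT)
    exact ⟨J, M, hJ, hM⟩
  · obtain ⟨hJ, hM⟩ := hJM
    have hy := hx.1.isFractionalJoin hT hJ.1
    refine ⟨hy, ?_⟩
    have h1 := hM.cost_le hc (ConnTJoin.even_card_wrongDegree hJ.1.1 hT) hy
    have h2 := hJ.cost_le_lpCost hc hx.1
    have h3 : ConnTJoin.lpCost ⊤ c (fun e => 1 / 3 * ConnTJoin.incidence J e + 1 / 3 * x e)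
        = 1 / 3 * ConnTJoin.cost c J.val + 1 / 3 * ConnTJoin.lpCost ⊤ c x := by
      rw [← ConnTJoin.lpCost_incidence hJ.1.1]
      simp only [ConnTJoin.lpCost, Finset.mul_sum, ← Finset.sum_add_distrib]
      exact Finset.sum_congr rfl fun e _ => by ring
    rw [h3] at h1
    rw [ConnTJoin.cost_add]
    linarith
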